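/- Let $a,b,c,d\in\mathbb R$ satisfy $a,b>0$, $d>\max(a,b)$, $c\ge a$, $c+1\ge b$ and $c-b\notin-\mathbb N_0$, where $\mathbb N_0=\{0,1,2,\dots\}$, and put $\delta=c+d-a-b>0$. On $(0,1)$ consider the weights $$w_1(x)={}_2F_1(c-b,d-b;\delta;1-x),\qquad w_2(x)=\tfrac cb\,{}_2F_1(c-b,d-b-1;\delta;1-x)$$ and the measure $$\mathrm d\mu(x)=\frac{\Gamma(c)\Gamma(d)}{\Gamma(a)\Gamma(b)\Gamma(\delta)}\,x^{a-1}(1-x)^{\delta-1}\,\mathrm dx .$$ Let $X=(1,x,x^2,\dots)^\top$, $X_1=(1,0,x,0,x^2,\dots)^\top$, $X_2=(0,1,0,x,0,x^2,\dots)^\top$, $\xi=X_1w_1+X_2w_2$, and let $g=\int_0^1X\xi^\top\,\mathrm d\mu$ be the moment matrix. Then the system $(w_1,w_2,\mathrm d\mu)$ is perfect, i.e. $g$ has a factorization $g=S^{-1}H\tilde S^{-\top}$ with $S,\tilde S$ semi-infinite lower unitriangular matrices and $H=\operatorname{diag}(H_0,H_1,\dots)$ with all $H_n\neq0$. For any such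 factorization let $$(B^{(n)})_{n\ge0}=SX,\qquad (A_i^{(n)})_{n\ge0}=H^{-1}\tilde SX_i\ (i=1,2),\qquad q^{(n)}=w_1A_1^{(n)}+w_2A_2^{(n)}$$ be the type II multiple orthogonal polynomials, the type I multiple orthogonal polynomials and the type I linear forms, and let $J=S\Lambda S^{-1}$ be the Jacobi matrix, where $\Lambda$ is the semi-infinite matrix with ones on the first superdiagonal and zeros elsewhere. Then $B^{(n)}(1)>0$ and $q^{(n)}(1)>0$ for all $n\in\mathbb N_0$, and the type II and type I hypergeometric stochastic matrices $$P_{II,n,m}=\frac{B^{(m)}(1)}{B^{(n)}(1)}\,J_{n,m},\qquad P_{I,n,m}=\frac{q^{(m)}(1)}{q^{(n)}(1)}\,J_{m,n}$$ are asymptotically transposes of each other: for every $k\in\{-2,-1,0,1,2\}$ both of the following limits exist, are finite, and $$\lim_{n\to\infty}P_{I,n,n+k}=\lim_{n\to\infty}P_{II,n+k,n}.$$ -/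

import Mathlib

open Filter Topology

noncomputable section

namespace HyperMOP

/-! ### Semi-infinite lower unitriangular matrices -/

/-- `S` is a semi-infinite lower unitriangular matrix. -/
structure IsLowerUnitri (S : ℕ → ℕ → ℝ) : Prop where
  diag : ∀ i, S i i = 1
  upper : ∀ i j, i < j → S i j = 0

/-- The inverse of a semi-infinite lower unitriangular matrix, by forward substitution. -/
def lowerInv (S : ℕ → ℕ → ℝ) (i j : ℕ) : ℝ :=
  if i = j then 1
  else if i < j then 0
  else -∑ k : Fin i, S i k * lowerInv S k j
termination_by i
decreasing_by exact k.2

theorem lowerInv_isLowerUnitri (S : ℕ → ℕ → ℝ) : IsLowerUnitri (lowerInv S) where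
  diag i := by rw [lowerInv]; simp
  upper i j h := by rw [lowerInv]; simp [h, h.ne]

/-- `lowerInv S` is a right inverse of `S`, as it should be; the row `i` of `S` vanishes
beyond the column `i`. -/
theorem mul_lowerInv {S : ℕ → ℕ → ℝ} (hS : IsLowerUnitri S) (i j : ℕ) :
    ∑ k ∈ Finset.range (i + 1), S i k * lowerInv S k j = if i = j then 1 else 0 := by
  rw [Finset.sum_range_succ, hS.diag, one_mul]
  rcases lt_trichotomy i j with h | h | h
  · rw [(lowerInv_isLowerUnitri S).upper i j h, if_neg h.ne, add_zero]
    refine Finset.sum_eq_zero fun k hk => ?_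
    rw [(lowerInv_isLowerUnitri S).upper k j ((Finset.mem_range.1 hk).trans h), mul_zero]
  · subst h
    rw [(lowerInv_isLowerUnitri S).diag, if_pos rfl, add_eq_right]
    refine Finset.sum_eq_zero fun k hk => ?_
    rw [(lowerInv_isLowerUnitri S).upper k i (Finset.mem_range.1 hk), mul_zero]
  · rw [lowerInv.eq_1 S i j, if_neg h.ne', if_neg h.ne', if_neg h.not_gt,
      Finset.sum_range, add_neg_cancel]

/-! ### The hypergeometric system of weights on `(0, 1)` -/

/-- `δ = c + d - a - b`. -/
def delta (a b c d : ℝ) : ℝ := c + d - a - b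

/-- The first weight `w₁(x) = ₂F₁(c - b, d - b; δ; 1 - x)`. -/
def w₁ (a b c d x : ℝ) : ℝ := ₂F₁ (c - b) (d - b) (delta a b c d) (1 - x)

/-- The second weight `w₂(x) = (c / b) ₂F₁(c - b, d - b - 1; δ; 1 - x)`. -/
def w₂ (a b c d x : ℝ) : ℝ := c / b * ₂F₁ (c - b) (d - b - 1) (delta a b c d) (1 - x)

/-- The density of the measure `μ` on `(0, 1)` with respect to Lebesgue measure. -/
def density (a b c d x : ℝ) : ℝ :=
  Real.Gamma c * Real.Gamma d / (Real.Gamma a * Real.Gamma b * Real.Gamma (delta a b c d)) *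
    x ^ (a - 1) * (1 - x) ^ (delta a b c d - 1)

/-- The vector of monomials `X₁ = (1, 0, x, 0, x², 0, …)`. -/
def X₁ (j : ℕ) (x : ℝ) : ℝ := if Even j then x ^ (j / 2) else 0

/-- The vector of monomials `X₂ = (0, 1, 0, x, 0, x², …)`. -/
def X₂ (j : ℕ) (x : ℝ) : ℝ := if Odd j then x ^ (j / 2) else 0

/-- The undressed linear forms `ξ = X₁ w₁ + X₂ w₂ = (w₁, w₂, x w₁, x w₂, …)`. -/
def xi (a b c d : ℝ) (j : ℕ) (x : ℝ) : ℝ :=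
  X₁ j x * w₁ a b c d x + X₂ j x * w₂ a b c d x

/-- The moment matrix `g = ∫ X(x) ξ(x)ᵀ dμ(x)`. -/
def moment (a b c d : ℝ) (i j : ℕ) : ℝ :=
  ∫ x in Set.Ioo (0 : ℝ) 1, x ^ i * xi a b c d j x * density a b c d x

/-! ### Gauss-Borel factorization and multiple orthogonal polynomials on the step-line -/

/-- `g = S⁻¹ H S̃⁻ᵀ` with `S`, `S̃ = T` lower unitriangular and `H` diagonal with nonzero entries.
The terms with `k > i` of the matrix product vanish. -/
structure IsGaussBorel (g S : ℕ → ℕ → ℝ) (H : ℕ → ℝ) (T : ℕ → ℕ → ℝ) : Prop where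
  left : IsLowerUnitri S
  right : IsLowerUnitri T
  diag_ne_zero : ∀ l, H l ≠ 0
  factor : ∀ i j, g i j =
    ∑ k ∈ Finset.range (i + 1), lowerInv S i k * H k * lowerInv T j k

/-- The monic type II polynomials, `B = S X`. -/
def typeII (S : ℕ → ℕ → ℝ) (n : ℕ) (x : ℝ) : ℝ := ∑ i ∈ Finset.range (n + 1), S n i * x ^ i

/-- The type I polynomials `A₁ = H⁻¹ S̃ X₁`. -/
def typeI₁ (H : ℕ → ℝ) (T : ℕ → ℕ → ℝ) (n : ℕ) (x : ℝ) : ℝ :=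
  (H n)⁻¹ * ∑ j ∈ Finset.range (n + 1), T n j * X₁ j x

/-- The type I polynomials `A₂ = H⁻¹ S̃ X₂`. -/
def typeI₂ (H : ℕ → ℝ) (T : ℕ → ℕ → ℝ) (n : ℕ) (x : ℝ) : ℝ :=
  (H n)⁻¹ * ∑ j ∈ Finset.range (n + 1), T n j * X₂ j x

/-- The type I linear forms `q⁽ⁿ⁾ = w₁ A₁⁽ⁿ⁾ + w₂ A₂⁽ⁿ⁾` of the hypergeometric system. -/
def linForm (a b c d : ℝ) (H : ℕ → ℝ) (T : ℕ → ℕ → ℝ) (n : ℕ) (x : ℝ) : ℝ :=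
  w₁ a b c d x * typeI₁ H T n x + w₂ a b c d x * typeI₂ H T n x

/-- The Jacobi matrix `J = S Λ S⁻¹`, where `Λ` is the shift matrix with ones on the first
superdiagonal. -/
def jacobi (S : ℕ → ℕ → ℝ) (n m : ℕ) : ℝ :=
  ∑ k ∈ Finset.range (n + 1), S n k * lowerInv S (k + 1) m

/-- The transition matrix of type II, with entries `B⁽ᵐ⁾(1) / B⁽ⁿ⁾(1) * J n m`. -/
def PII (S : ℕ → ℕ → ℝ) (n m : ℕ) : ℝ := typeII S m 1 / typeII S n 1 * jacobi S n m

/-- The transition matrix of type I, with entries `q⁽ᵐ⁾(1) / q⁽ⁿ⁾(1) * J m n`. -/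
def PI (a b c d : ℝ) (S : ℕ → ℕ → ℝ) (H : ℕ → ℝ) (T : ℕ → ℕ → ℝ) (n m : ℕ) : ℝ :=
  linForm a b c d H T m 1 / linForm a b c d H T n 1 * jacobi S m n

end HyperMOP

end

/-! Write `B n` and `q n` for the values at 1 of the type II polynomials and of the type I linear
forms. Gauss' summation theorem makes the moments quotients of Pochhammer symbols, and the second
weight is the first one with `b`, `c` raised by 1. So all orthogonality relations of the `₃F₂`
polynomials become alternating binomial sums of polynomials of degree below `n`, which vanish
(`sum_typeIICoeff_mul`). The diagonal entries are such sums with one simple pole left, hence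
explicit and nonzero: this gives the factorization, and `left_unique` identifies `S` in any other
one.

The same vanishing gives `S⁻¹` in closed form. Its column `n` lists the moments of the `n`-th linear
form; divided by the moments of `w₁` it tends to `q n`, because high moments only see `x = 1`. This
yields an explicit positive `q n`, and the same limit in `S⁻¹ J = Λ S⁻¹` shows that `q` is a left
eigenvector of `J` for the eigenvalue 1. `B` is a right eigenvector because `J S = S Λ`.

`J` has four diagonals, so `J B = B` is a third-order recurrence. In the limit its characteristic
equation is `(z + 4/27)³ = z²`, with the double root `8/27` and the root `-1/27`; the ratio
asymptotics of `B` are therefore delicate. Pairing with the left eigenvector `q` lowers the order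
(`linFormOne_mul_typeII`): the new recurrence has positive coefficients, which gives `B n > 0`, and
in the limit the roots `8/27` and `-1/27`, so that `B (n+1) / B n → 8/27` by a contraction argument.
The explicit `q n / q (n+1)` also tends to `8/27`. Since the diagonals of `J` converge, the
transition matrices have the same limits along corresponding diagonals. -/

noncomputable section

namespace HyperMOP

/-! ### Pochhammer symbols -/

/-- The rising factorial `(x)_n = x (x + 1) ⋯ (x + n - 1)`. -/
def poch (x : ℝ) (n : ℕ) : ℝ := ∏ i ∈ Finset.range n, (x + i)

@[simp] theorem poch_zero (x : ℝ) : poch x 0 = 1 := by simp [poch]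

theorem poch_succ (x : ℝ) (n : ℕ) : poch x (n + 1) = poch x n * (x + n) := by
  simp [poch, Finset.prod_range_succ]

theorem poch_succ' (x : ℝ) (n : ℕ) : poch x (n + 1) = x * poch (x + 1) n := by
  simp only [poch, Finset.prod_range_succ', Nat.cast_zero, add_zero, mul_comm x]
  congr 1
  refine Finset.prod_congr rfl fun i _ => ?_
  push_cast; ring

theorem poch_add (x : ℝ) (m n : ℕ) : poch x (m + n) = poch x m * poch (x + m) n := by
  simp only [poch, Finset.prod_range_add]
  congr 1
  refine Finset.prod_congr rfl fun i _ => ?_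
  push_cast; ring

theorem poch_pos {x : ℝ} (hx : 0 < x) (n : ℕ) : 0 < poch x n :=
  Finset.prod_pos fun i _ => by positivity

theorem poch_ne_zero {x : ℝ} (hx : 0 < x) (n : ℕ) : poch x n ≠ 0 := (poch_pos hx n).ne'

theorem poch_mono {x y : ℝ} (hx : 0 < x) (hxy : x ≤ y) (n : ℕ) : poch x n ≤ poch y n :=
  Finset.prod_le_prod (fun i _ => by positivity) fun i _ => by linarith

theorem ascPochhammer_eval_eq_poch (x : ℝ) (n : ℕ) : (ascPochhammer ℝ n).eval x = poch x n := by
  induction n with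
  | zero => simp
  | succ n ih => rw [ascPochhammer_succ_eval, ih, poch_succ]

theorem Gamma_add_nat {x : ℝ} (hx : 0 < x) (n : ℕ) :
    Real.Gamma (x + n) = Real.Gamma x * poch x n := by
  induction n with
  | zero => simp
  | succ n ih =>
    have : x + n ≠ 0 := by positivity
    push_cast
    rw [← add_assoc, Real.Gamma_add_one this, ih, poch_succ]; ring

/-! ### Gauss' summation theorem -/

/-- The terms of the series `₂F₁(A, B; C; 1)`. -/
def gaussTerm (A B C : ℝ) (k : ℕ) : ℝ := poch A k * poch B k / (poch C k * k.factorial)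

@[simp] theorem gaussTerm_zero (A B C : ℝ) : gaussTerm A B C 0 = 1 := by simp [gaussTerm]

theorem gaussTerm_succ {C : ℝ} (A B : ℝ) (hC : 0 < C) (k : ℕ) :
    gaussTerm A B C (k + 1) = gaussTerm A B C k * ((A + k) * (B + k) / ((C + k) * (k + 1))) := by
  have h1 := poch_ne_zero hC k
  have h2 : C + k ≠ 0 := by positivity
  have h3 : ((k.factorial : ℕ) : ℝ) ≠ 0 := by positivity
  simp only [gaussTerm, poch_succ, Nat.factorial_succ, Nat.cast_mul, Nat.cast_add, Nat.cast_one]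
  field_simp

theorem gaussTerm_telescope {C : ℝ} (A B : ℝ) (hC : 0 < C) (k : ℕ) :
    k * gaussTerm A B C k - (k + 1 : ℕ) * gaussTerm A B C (k + 1)
      = gaussTerm A B C k * (((C - A - B) * k - A * B) / (C + k)) := by
  have h2 : C + k ≠ 0 := by positivity
  rw [gaussTerm_succ A B hC]
  push_cast
  field_simp
  ring

/-- From the index 1 on, consecutive terms have a nonnegative quotient because `A, B > -1`, so the
telescoping identity survives absolute values. -/
theorem abs_gaussTerm_telescope {A B C : ℝ} (hA : -1 < A) (hB : -1 < B) (hC : 0 < C) (k : ℕ) :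
    (k + 1 : ℕ) * |gaussTerm A B C (k + 1)| - (k + 2 : ℕ) * |gaussTerm A B C (k + 2)|
      = |gaussTerm A B C (k + 1)| * (((C - A - B) * (k + 1 : ℕ) - A * B) / (C + (k + 1 : ℕ))) := by
  have h2 : C + (k + 1) ≠ 0 := by positivity
  have h3 : 0 ≤ (A + (k + 1 : ℕ)) * (B + (k + 1 : ℕ)) / ((C + (k + 1 : ℕ)) * ((k + 1 : ℕ) + 1)) := by
    have : (0 : ℝ) ≤ k := by positivity
    have : 0 < A + (k + 1 : ℕ) := by push_cast; linarith
    have : 0 < B + (k + 1 : ℕ) := by push_cast; linarith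
    positivity
  rw [gaussTerm_succ A B hC (k + 1), abs_mul, abs_of_nonneg h3]
  push_cast
  have h4 : (k : ℝ) + 1 + 1 ≠ 0 := by positivity
  field_simp
  ring

/-- Raabe's criterion: eventually `k |t k|` drops by at least `ε |t k|` at each step, which bounds
the partial sums. -/
theorem summable_gaussTerm {A B C : ℝ} (hA : -1 < A) (hB : -1 < B) (hC : 0 < C)
    (hCAB : A + B < C) : Summable fun k => |gaussTerm A B C k| := by
  obtain ⟨ε, hε, N, hN⟩ : ∃ ε > 0, ∃ N : ℕ, ∀ k ≥ N,
      ε ≤ ((C - A - B) * (k + 1 : ℕ) - A * B) / (C + (k + 1 : ℕ)) := by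
    -- Half of the limit `C - A - B` of the right-hand side.
    refine ⟨(C - A - B) / 2, by linarith, ?_⟩
    obtain ⟨N, hN⟩ := exists_nat_gt ((C - A - B + 2 * |A * B| / (C - A - B)) + C)
    refine ⟨N, fun k hk => ?_⟩
    have hk' : (N : ℝ) ≤ k := by exact_mod_cast hk
    have hp : 0 < C - A - B := by linarith
    rw [le_div_iff₀ (by positivity)]
    have h1 : 2 * |A * B| / (C - A - B) ≤ k + 1 - C := by linarith
    rw [div_le_iff₀ hp] at h1
    have := le_abs_self (A * B)
    push_cast
    nlinarith
  rw [← summable_nat_add_iff (N + 1)]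
  refine summable_of_sum_range_le (c := (N + 1 : ℕ) * |gaussTerm A B C (N + 1)| / ε)
    (fun _ => abs_nonneg _) fun n => ?_
  rw [le_div_iff₀ hε]
  have key : ∀ n, (∑ k ∈ Finset.range n, |gaussTerm A B C (k + (N + 1))|) * ε ≤
      (N + 1 : ℕ) * |gaussTerm A B C (N + 1)|
        - (n + N + 1 : ℕ) * |gaussTerm A B C (n + N + 1)| := by
    intro n
    induction n with
    | zero => simp
    | succ n ih =>
      have h := abs_gaussTerm_telescope hA hB hC (n + N)
      have h1 := mul_le_mul_of_nonneg_left (hN (n + N) (by omega))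
        (abs_nonneg (gaussTerm A B C (n + N + 1)))
      rw [Finset.sum_range_succ, add_mul, show n + (N + 1) = n + N + 1 by ring,
        show n + 1 + N + 1 = n + N + 2 by ring]
      linarith
  have h2 : 0 ≤ (n + N + 1 : ℕ) * |gaussTerm A B C (n + N + 1)| := by positivity
  linarith [key n]

/-- The differences of `k t k` are summable, so a limit exists; a nonzero limit would make the
harmonic series converge by comparison with `t`. -/
theorem tendsto_nat_mul_gaussTerm {A B C : ℝ} (hA : -1 < A) (hB : -1 < B) (hC : 0 < C)
    (hCAB : A + B < C) : Tendsto (fun k : ℕ => k * gaussTerm A B C k) atTop (𝓝 0) := by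
  have hs := summable_gaussTerm hA hB hC hCAB
  have hs' : Summable (gaussTerm A B C) := hs.of_abs
  have hbdd : ∀ k : ℕ, |((C - A - B) * k - A * B) / (C + k)| ≤ (C - A - B) + |A * B| / C := by
    intro k
    have hp : 0 < C - A - B := by linarith
    rw [abs_div, abs_of_pos (show 0 < C + (k : ℝ) by positivity), div_le_iff₀ (by positivity)]
    have h1 : |(C - A - B) * k - A * B| ≤ (C - A - B) * k + |A * B| := by
      refine (abs_sub _ _).trans ?_
      rw [abs_of_nonneg (by positivity)]
    have h2 : |A * B| ≤ |A * B| / C * (C + k) := by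
      rw [mul_add, div_mul_cancel₀ _ hC.ne']
      have : 0 ≤ |A * B| / C * k := by positivity
      linarith
    nlinarith
  have hsum : Summable fun k : ℕ =>
      gaussTerm A B C k * (((C - A - B) * k - A * B) / (C + k)) := by
    refine Summable.of_abs (Summable.of_nonneg_of_le (fun _ => abs_nonneg _) (fun k => ?_)
      (hs.mul_right ((C - A - B) + |A * B| / C)))
    rw [abs_mul]
    exact mul_le_mul_of_nonneg_left (hbdd k) (abs_nonneg _)
  obtain ⟨l, hl⟩ : ∃ l, Tendsto (fun k : ℕ => k * gaussTerm A B C k) atTop (𝓝 l) := by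
    have h := hsum.hasSum.tendsto_sum_nat
    have h2 : ∀ n : ℕ, ∑ k ∈ Finset.range n,
        gaussTerm A B C k * (((C - A - B) * k - A * B) / (C + k)) = - (n * gaussTerm A B C n) := by
      intro n
      induction n with
      | zero => simp
      | succ n ih =>
        rw [Finset.sum_range_succ, ih, ← gaussTerm_telescope A B hC]; push_cast; ring
    simp only [h2] at h
    exact ⟨_, by simpa using h.neg⟩
  suffices l = 0 by rwa [this] at hl
  by_contra hne
  have hpos : 0 < |l| := abs_pos.2 hne
  have hev : ∀ᶠ k : ℕ in atTop, |l| / 2 < |k * gaussTerm A B C k| :=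
    hl.abs.eventually (lt_mem_nhds (by linarith))
  have hev2 : ∀ᶠ k : ℕ in atTop, ‖|l| / 2 * (1 / (k : ℝ))‖ ≤ |gaussTerm A B C k| := by
    filter_upwards [hev, eventually_gt_atTop 0] with k hk hk0
    have hk0' : (0 : ℝ) < k := by exact_mod_cast hk0
    rw [abs_mul, abs_of_pos hk0'] at hk
    rw [Real.norm_of_nonneg (by positivity), mul_one_div, div_le_iff₀ hk0', mul_comm]
    exact hk.le
  have := Summable.of_norm_bounded_eventually_nat hs hev2
  rw [summable_mul_left_iff (by positivity)] at this
  exact Real.not_summable_one_div_natCast this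

theorem gaussTerm_add_one {C : ℝ} (A B : ℝ) (hC : 0 < C) (k : ℕ) :
    gaussTerm A B (C + 1) k = gaussTerm A B C k * (C / (C + k)) := by
  have h : C * poch (C + 1) k = poch C k * (C + k) := by rw [← poch_succ', poch_succ]
  have h1 := poch_ne_zero hC k
  have h2 : C + k ≠ 0 := by positivity
  have h3 := poch_ne_zero (show 0 < C + 1 by positivity) k
  have h4 : poch (C + 1) k = poch C k * (C + k) / C := by
    rw [eq_div_iff hC.ne', ← h]; ring
  rw [gaussTerm, gaussTerm, h4]
  field_simp

/-- The partial sums of the difference of the two sides telescope to `-C n t n`, which tends to 0.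
-/
theorem tsum_gaussTerm_add_one {A B C : ℝ} (hA : -1 < A) (hB : -1 < B) (hC : 0 < C)
    (hCAB : A + B < C) :
    C * (C - A - B) * ∑' k, gaussTerm A B C k
      = (C - A) * (C - B) * ∑' k, gaussTerm A B (C + 1) k := by
  have hs : Summable (gaussTerm A B C) := (summable_gaussTerm hA hB hC hCAB).of_abs
  have hs1 : Summable (gaussTerm A B (C + 1)) :=
    (summable_gaussTerm hA hB (by linarith) (by linarith)).of_abs
  rw [← sub_eq_zero, ← tsum_mul_left, ← tsum_mul_left,
    ← (hs.mul_left _).tsum_sub (hs1.mul_left _)]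
  have h := ((hs.mul_left (C * (C - A - B))).sub
    (hs1.mul_left ((C - A) * (C - B)))).hasSum.tendsto_sum_nat
  refine tendsto_nhds_unique h ?_
  have h2 : ∀ n : ℕ, ∑ k ∈ Finset.range n, (C * (C - A - B) * gaussTerm A B C k
      - (C - A) * (C - B) * gaussTerm A B (C + 1) k) = - C * (n * gaussTerm A B C n) := by
    intro n
    induction n with
    | zero => simp
    | succ n ih =>
      have h0 : C + n ≠ 0 := by positivity
      rw [Finset.sum_range_succ, ih, gaussTerm_add_one A B hC]
      have := gaussTerm_telescope A B hC n
      have h3 : C * (C - A - B) * gaussTerm A B C n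
          - (C - A) * (C - B) * (gaussTerm A B C n * (C / (C + n)))
          = C * (gaussTerm A B C n * (((C - A - B) * n - A * B) / (C + n))) := by
        field_simp; ring
      rw [h3, ← this]; ring
  simp only [h2]
  simpa using (tendsto_nat_mul_gaussTerm hA hB hC hCAB).const_mul (-C)

theorem tendsto_tsum_gaussTerm {A B C : ℝ} (hA : -1 < A) (hB : -1 < B) (hC : 0 < C)
    (hCAB : A + B < C) :
    Tendsto (fun N : ℕ => ∑' k, gaussTerm A B (C + N) k) atTop (𝓝 1) := by
  have hlim : ∀ k, Tendsto (fun N : ℕ => gaussTerm A B (C + N) k) atTop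
      (𝓝 (if k = 0 then 1 else 0)) := by
    intro k
    rcases k with _ | k
    · simp
    · simp only [Nat.succ_ne_zero, if_false, gaussTerm]
      refine Tendsto.div_atTop tendsto_const_nhds ?_
      refine Tendsto.atTop_mul_const (by positivity) ?_
      refine tendsto_atTop_mono (f := fun N : ℕ => (N : ℝ) * poch (C + 1) k) (fun N => ?_)
        (tendsto_natCast_atTop_atTop.atTop_mul_const (poch_pos (by linarith) k))
      rw [poch_succ']
      have : (0 : ℝ) ≤ N := by positivity
      exact mul_le_mul (by linarith) (poch_mono (by linarith) (by linarith) k)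
        (poch_pos (by linarith) k).le (by positivity)
  have := tendsto_tsum_of_dominated_convergence (𝓕 := atTop)
    (f := fun (N : ℕ) k => gaussTerm A B (C + N) k) (summable_gaussTerm hA hB hC hCAB) hlim
    (Eventually.of_forall fun N k => ?_)
  · simpa using this
  · rw [Real.norm_eq_abs, gaussTerm, gaussTerm, abs_div, abs_div]
    have h1 := poch_pos hC k
    have h2 : poch C k ≤ poch (C + N) k := poch_mono hC (by simp) k
    rw [abs_of_pos (a := poch C k * _) (by positivity),
      abs_of_pos (a := poch (C + N) k * _) (by have := h1.trans_le h2; positivity)]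
    gcongr

/-- Euler's limit formula for the four Gamma values; the powers of `n` cancel because `C + (C - A -
B) = (C - A) + (C - B)`. -/
theorem tendsto_poch_ratio {A B C : ℝ} (hC : 0 < C) (hCAB : A + B < C) (hCA : A < C)
    (hCB : B < C) :
    Tendsto (fun n : ℕ => poch (C - A) n * poch (C - B) n / (poch C n * poch (C - A - B) n)) atTop
      (𝓝 (Real.Gamma C * Real.Gamma (C - A - B) / (Real.Gamma (C - A) * Real.Gamma (C - B)))) := by
  have h0 := ((Real.GammaSeq_tendsto_Gamma C).mul (Real.GammaSeq_tendsto_Gamma (C - A - B))).div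
    ((Real.GammaSeq_tendsto_Gamma (C - A)).mul (Real.GammaSeq_tendsto_Gamma (C - B)))
    (mul_pos (Real.Gamma_pos_of_pos (by linarith)) (Real.Gamma_pos_of_pos (by linarith))).ne'
  rw [← tendsto_add_atTop_iff_nat 1]
  refine h0.congr' ?_
  filter_upwards [eventually_gt_atTop 0] with n hn
  have hn' : (0 : ℝ) < n := by exact_mod_cast hn
  have hseq : ∀ s : ℝ, Real.GammaSeq s n = (n : ℝ) ^ s * n.factorial / poch s (n + 1) := by
    intro s; rfl
  simp only [Pi.div_apply, hseq]
  have h1 := poch_ne_zero hC (n + 1)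
  have h2 := poch_ne_zero (show 0 < C - A by linarith) (n + 1)
  have h3 := poch_ne_zero (show 0 < C - B by linarith) (n + 1)
  have h4 := poch_ne_zero (show 0 < C - A - B by linarith) (n + 1)
  have h5 : (n : ℝ) ^ C * (n : ℝ) ^ (C - A - B) = (n : ℝ) ^ (C - A) * (n : ℝ) ^ (C - B) := by
    rw [← Real.rpow_add hn', ← Real.rpow_add hn']; ring_nf
  have h6 := (Real.rpow_pos_of_pos hn' (C - A)).ne'
  have h7 := (Real.rpow_pos_of_pos hn' (C - B)).ne'
  have h8 : ((n.factorial : ℕ) : ℝ) ≠ 0 := by positivity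
  rw [div_eq_div_iff (by positivity) (by positivity)]
  field_simp
  linear_combination h5

/-- Gauss' summation theorem. -/
theorem tsum_gaussTerm {A B C : ℝ} (hA : -1 < A) (hB : -1 < B) (hC : 0 < C) (hCAB : A + B < C)
    (hCA : A < C) (hCB : B < C) :
    ∑' k, gaussTerm A B C k =
      Real.Gamma C * Real.Gamma (C - A - B) / (Real.Gamma (C - A) * Real.Gamma (C - B)) := by
  -- Iterate the contiguity relation `C → C + 1`, then let `N → ∞`: the remaining series tends to 1
  -- and the prefactor to the Gamma quotient.
  have key : ∀ N : ℕ, ∑' k, gaussTerm A B C k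
      = poch (C - A) N * poch (C - B) N / (poch C N * poch (C - A - B) N)
        * ∑' k, gaussTerm A B (C + N) k := by
    intro N
    induction N with
    | zero => simp
    | succ N ih =>
      have hN : (0 : ℝ) ≤ N := by positivity
      have h := tsum_gaussTerm_add_one (A := A) (B := B) (C := C + N) hA hB (by linarith)
        (by linarith)
      rw [ih]
      simp only [poch_succ]
      have h1 := poch_ne_zero hC N
      have h2 := poch_ne_zero (show 0 < C - A - B by linarith) N
      have h3 : C + N ≠ 0 := by positivity
      have h4 : C - A - B + N ≠ 0 := by have : 0 < C - A - B + N := by linarith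
                                        exact this.ne'
      rw [show (C + N - A - B) = C - A - B + N by ring, show C + N - A = C - A + N by ring,
        show C + N - B = C - B + N by ring, show C + N + 1 = C + (N + 1 : ℕ) by push_cast; ring] at h
      field_simp
      linear_combination poch (C - A) N * poch (C - B) N * h
  have hlim := (tendsto_poch_ratio hC hCAB hCA hCB).mul (tendsto_tsum_gaussTerm hA hB hC hCAB)
  rw [mul_one] at hlim
  exact tendsto_nhds_unique (tendsto_const_nhds.congr key) hlim

/-! ### The moments of the hypergeometric weights -/

theorem beta_integrand_ofReal {u v x : ℝ} (hx : x ∈ Set.Ioo (0 : ℝ) 1) :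
    ((x : ℂ) ^ ((u : ℂ) - 1) * (1 - (x : ℂ)) ^ ((v : ℂ) - 1)) =
      ((x ^ (u - 1) * (1 - x) ^ (v - 1) : ℝ) : ℂ) := by
  have h1 : 0 ≤ 1 - x := by linarith [hx.2]
  rw [Complex.ofReal_mul, Complex.ofReal_cpow hx.1.le, Complex.ofReal_cpow h1]
  push_cast
  rfl

theorem integrableOn_beta {u v : ℝ} (hu : 0 < u) (hv : 0 < v) :
    MeasureTheory.IntegrableOn (fun x : ℝ => x ^ (u - 1) * (1 - x) ^ (v - 1))
      (Set.Ioo 0 1) := by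
  have h := Complex.betaIntegral_convergent (u := u) (v := v) (by simpa) (by simpa)
  rw [intervalIntegrable_iff_integrableOn_Ioo_of_le zero_le_one] at h
  refine (MeasureTheory.IntegrableOn.congr_fun (f := fun x : ℝ =>
    ((x : ℂ) ^ ((u : ℂ) - 1) * (1 - (x : ℂ)) ^ ((v : ℂ) - 1)).re) h.re (fun x hx => ?_)
    measurableSet_Ioo)
  simp only [beta_integrand_ofReal hx, Complex.ofReal_re]

theorem integral_beta {u v : ℝ} (hu : 0 < u) (hv : 0 < v) :
    ∫ x in Set.Ioo (0 : ℝ) 1, x ^ (u - 1) * (1 - x) ^ (v - 1)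
      = Real.Gamma u * Real.Gamma v / Real.Gamma (u + v) := by
  have h := Complex.betaIntegral_eq_Gamma_mul_div u v (by simpa) (by simpa)
  rw [Complex.betaIntegral, intervalIntegral.integral_of_le zero_le_one,
    MeasureTheory.integral_Ioc_eq_integral_Ioo,
    MeasureTheory.setIntegral_congr_fun measurableSet_Ioo
      (fun x hx => beta_integrand_ofReal (u := u) (v := v) hx), integral_complex_ofReal,
    ← Complex.ofReal_add, Complex.Gamma_ofReal, Complex.Gamma_ofReal, Complex.Gamma_ofReal] at h
  exact_mod_cast h

theorem hypergeometric_eq_tsum (A B C x : ℝ) :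
    ₂F₁ A B C x = ∑' k, gaussTerm A B C k * x ^ k := by
  rw [ordinaryHypergeometric_eq_tsum]
  refine tsum_congr fun k => ?_
  simp only [ascPochhammer_eval_eq_poch, gaussTerm, smul_eq_mul, div_eq_mul_inv, mul_inv]
  ring

/-- Termwise integration: the Beta integral of the `k`-th term replaces `(v)_k` by `(u + v)_k` in
the denominator, leaving a Gauss series at 1. Its absolute convergence justifies the interchange. -/
theorem integral_beta_mul_hypergeometric {A B u v : ℝ} (hA : -1 < A) (hB : -1 < B) (hu : 0 < u)
    (hv : 0 < v) (hAB : A + B < u + v) (hAu : A < u + v) (hBu : B < u + v) :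
    ∫ x in Set.Ioo (0 : ℝ) 1, x ^ (u - 1) * (1 - x) ^ (v - 1) * ₂F₁ A B v (1 - x)
      = Real.Gamma u * Real.Gamma v * Real.Gamma (u + v - A - B) /
        (Real.Gamma (u + v - A) * Real.Gamma (u + v - B)) := by
  have huv : 0 < u + v := by positivity
  have hpt : ∀ k : ℕ, ∀ x ∈ Set.Ioo (0 : ℝ) 1,
      x ^ (u - 1) * (1 - x) ^ (v + k - 1) = x ^ (u - 1) * (1 - x) ^ (v - 1) * (1 - x) ^ k := by
    intro k x hx
    have : 0 < 1 - x := by linarith [hx.2]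
    rw [show v + k - 1 = v - 1 + k by ring, Real.rpow_add_natCast this.ne']
    ring
  have hint : ∀ k : ℕ, MeasureTheory.IntegrableOn (fun x : ℝ =>
      x ^ (u - 1) * (1 - x) ^ (v - 1) * (gaussTerm A B v k * (1 - x) ^ k)) (Set.Ioo 0 1) := by
    intro k
    have h := (integrableOn_beta hu (show 0 < v + k by positivity)).const_mul (gaussTerm A B v k)
    refine MeasureTheory.IntegrableOn.congr_fun h (fun x hx => ?_) measurableSet_Ioo
    simp only [hpt k x hx]; ring
  have hval : ∀ (k : ℕ) (r : ℝ), ∫ x in Set.Ioo (0 : ℝ) 1,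
      x ^ (u - 1) * (1 - x) ^ (v - 1) * (r * (1 - x) ^ k)
        = Real.Gamma u * Real.Gamma v / Real.Gamma (u + v) * (r * (poch v k / poch (u + v) k)) := by
    intro k r
    have h := integral_beta hu (show 0 < v + k by positivity)
    rw [← add_assoc, Gamma_add_nat hv, Gamma_add_nat huv] at h
    rw [MeasureTheory.setIntegral_congr_fun measurableSet_Ioo (g := fun x =>
      r * (x ^ (u - 1) * (1 - x) ^ (v + k - 1))), MeasureTheory.integral_const_mul, h]
    · have := poch_ne_zero huv k
      have := (Real.Gamma_pos_of_pos huv).ne'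
      field_simp
    · intro x hx
      simp only [hpt k x hx]; ring
  have hterm : ∀ k, gaussTerm A B v k * (poch v k / poch (u + v) k) = gaussTerm A B (u + v) k := by
    intro k
    have h1 := poch_ne_zero hv k
    have h2 := poch_ne_zero huv k
    simp only [gaussTerm]
    field_simp
  have hnorm : ∀ k : ℕ, ∫ x in Set.Ioo (0 : ℝ) 1,
      ‖x ^ (u - 1) * (1 - x) ^ (v - 1) * (gaussTerm A B v k * (1 - x) ^ k)‖
        = Real.Gamma u * Real.Gamma v / Real.Gamma (u + v) * |gaussTerm A B (u + v) k| := by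
    intro k
    rw [← hterm, abs_mul, abs_of_pos (div_pos (poch_pos hv k) (poch_pos huv k)), ← hval]
    refine MeasureTheory.setIntegral_congr_fun measurableSet_Ioo fun x hx => ?_
    have h1 : 0 < 1 - x := by linarith [hx.2]
    have h0 := hx.1
    simp only [Real.norm_eq_abs, abs_mul]
    rw [abs_of_pos (Real.rpow_pos_of_pos h0 _), abs_of_pos (Real.rpow_pos_of_pos h1 _),
      abs_of_pos (pow_pos h1 k)]
  have hs := summable_gaussTerm hA hB huv hAB
  have h := MeasureTheory.hasSum_integral_of_summable_integral_norm hint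
    (by simp only [hnorm]; exact hs.mul_left _)
  have h' := h.tsum_eq
  simp only [hval, hterm] at h'
  rw [tsum_mul_left, tsum_gaussTerm hA hB huv hAB hAu hBu] at h'
  simp only [hypergeometric_eq_tsum, ← tsum_mul_left]
  rw [← h']
  have := (Real.Gamma_pos_of_pos huv).ne'
  field_simp

/-- The moments `(a)_i (b)_i / ((c)_i (d)_i)`. -/
def pochRatio (a b c d : ℝ) (i : ℕ) : ℝ := poch a i * poch b i / (poch c i * poch d i)

/-- The parameters `a`, `b`, `c`, `d` of a hypergeometric system that is perfect and has
positive normalizing factors. -/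
structure Admissible (a b c d : ℝ) : Prop where
  a_pos : 0 < a
  b_pos : 0 < b
  a_lt_d : a < d
  b_lt_d : b < d
  a_le_c : a ≤ c
  b_lt_c : b < c + 1
  c_ne_b : c ≠ b

theorem Admissible.c_pos {a b c d : ℝ} (h : Admissible a b c d) : 0 < c := h.a_pos.trans_le h.a_le_c

theorem Admissible.d_pos {a b c d : ℝ} (h : Admissible a b c d) : 0 < d := h.a_pos.trans h.a_lt_d

/-- Stated with `b < d + 1` instead of `b < d` so that it also applies to the second weight, where
`b` and `c` are raised by 1. -/
theorem setIntegral_weight {a b c d : ℝ} (ha : 0 < a) (hb : 0 < b) (had : a < d)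
    (hbd : b < d + 1) (hbc : b < c + 1) (hc : 0 < c) (hd : 0 < d) (hδ : 0 < delta a b c d)
    (i : ℕ) :
    ∫ x in Set.Ioo (0 : ℝ) 1, x ^ i * ₂F₁ (c - b) (d - b) (delta a b c d) (1 - x) *
      density a b c d x = pochRatio a b c d i := by
  have hi : (0 : ℝ) ≤ i := by positivity
  have e1 : a + i + delta a b c d = c + d - b + i := by rw [delta]; ring
  have h := integral_beta_mul_hypergeometric (A := c - b) (B := d - b) (u := a + i)
    (v := delta a b c d) (by linarith) (by linarith) (by positivity) hδ
    (by linarith) (by linarith) (by linarith)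
  have e2 : c + d - b + i - (c - b) - (d - b) = b + i := by ring
  have e3 : c + d - b + i - (c - b) = d + i := by ring
  have e4 : c + d - b + i - (d - b) = c + i := by ring
  rw [e1, e2, e3, e4, Gamma_add_nat ha, Gamma_add_nat hb, Gamma_add_nat hc,
    Gamma_add_nat hd] at h
  rw [MeasureTheory.setIntegral_congr_fun measurableSet_Ioo (g := fun x =>
      (Real.Gamma c * Real.Gamma d / (Real.Gamma a * Real.Gamma b * Real.Gamma (delta a b c d))) *
      (x ^ (a + i - 1) * (1 - x) ^ (delta a b c d - 1) *
        ₂F₁ (c - b) (d - b) (delta a b c d) (1 - x))),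
    MeasureTheory.integral_const_mul, h, pochRatio]
  · have g1 := (Real.Gamma_pos_of_pos ha).ne'
    have g2 := (Real.Gamma_pos_of_pos hb).ne'
    have g3 := (Real.Gamma_pos_of_pos hc).ne'
    have g4 := (Real.Gamma_pos_of_pos hd).ne'
    have g5 := (Real.Gamma_pos_of_pos hδ).ne'
    have g6 := poch_ne_zero hc i
    have g7 := poch_ne_zero hd i
    field_simp
  · intro x hx
    simp only [density]
    rw [show a + i - 1 = a - 1 + i by ring, Real.rpow_add_natCast hx.1.ne']
    ring

namespace Admissible
variable {a b c d : ℝ}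

theorem delta_pos (h : Admissible a b c d) : 0 < delta a b c d := by
  have := h.b_lt_d; have := h.a_le_c
  rw [delta]; linarith

theorem moment_even (h : Admissible a b c d) (i j : ℕ) :
    moment a b c d i (2 * j) = pochRatio a b c d (i + j) := by
  rw [← setIntegral_weight h.a_pos h.b_pos h.a_lt_d (by linarith [h.b_lt_d]) h.b_lt_c h.c_pos
    h.d_pos h.delta_pos, moment]
  refine MeasureTheory.setIntegral_congr_fun measurableSet_Ioo fun x _ => ?_
  have h1 : ¬ Odd (2 * j) := by simp
  simp only [xi, X₁, X₂, w₁, even_two_mul, if_true, h1, if_false, pow_add]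
  rw [Nat.mul_div_cancel_left j two_pos]
  ring

/-- Raising `b` and `c` by 1 keeps `δ` and turns `w₁` into `w₂` without its factor `c / b`; that
factor is the change of the Gamma prefactor of the density. -/
theorem moment_odd (h : Admissible a b c d) (i j : ℕ) :
    moment a b c d i (2 * j + 1) = pochRatio a (b + 1) (c + 1) d (i + j) := by
  have hb := h.b_pos
  have hc := h.c_pos
  have e : delta a (b + 1) (c + 1) d = delta a b c d := by simp only [delta]; ring
  rw [← setIntegral_weight h.a_pos (by linarith) h.a_lt_d (by linarith [h.b_lt_d])
    (by linarith [h.b_lt_c]) (by linarith) h.d_pos (e ▸ h.delta_pos), moment]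
  refine MeasureTheory.setIntegral_congr_fun measurableSet_Ioo fun x _ => ?_
  have h1 : ¬ Even (2 * j + 1) := by simp
  have h2 : Odd (2 * j + 1) := ⟨j, rfl⟩
  simp only [xi, X₁, X₂, w₂, h1, h2, if_true, if_false, pow_add, density, e]
  rw [show (2 * j + 1) / 2 = j by omega, Real.Gamma_add_one hb.ne', Real.Gamma_add_one hc.ne',
    show c + 1 - (b + 1) = c - b by ring, show d - (b + 1) = d - b - 1 by ring]
  have g1 := (Real.Gamma_pos_of_pos h.a_pos).ne'
  have g2 := (Real.Gamma_pos_of_pos hb).ne'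
  have g5 := (Real.Gamma_pos_of_pos h.delta_pos).ne'
  field_simp
  ring

end Admissible

/-! ### Products of semi-infinite lower triangular matrices -/

/-- The product of semi-infinite matrices, the left one being lower triangular. -/
def lmul (A B : ℕ → ℕ → ℝ) (i j : ℕ) : ℝ := ∑ k ∈ Finset.range (i + 1), A i k * B k j

/-- The semi-infinite identity matrix. -/
def lone (i j : ℕ) : ℝ := if i = j then 1 else 0

theorem lmul_assoc {B : ℕ → ℕ → ℝ} (hB : ∀ i j, i < j → B i j = 0) (A C : ℕ → ℕ → ℝ) :
    lmul (lmul A B) C = lmul A (lmul B C) := by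
  funext i j
  simp only [lmul, Finset.sum_mul, Finset.mul_sum]
  rw [Finset.sum_comm]
  refine Finset.sum_congr rfl fun p hp => ?_
  have hp' := Finset.mem_range.1 hp
  rw [← Finset.sum_subset (Finset.range_mono (show p + 1 ≤ i + 1 by omega))]
  · exact Finset.sum_congr rfl fun k _ => by ring
  · intro k _ hk
    rw [hB p k (by simpa using hk)]; ring

theorem lone_lmul (A : ℕ → ℕ → ℝ) : lmul lone A = A := by
  funext i j
  simp [lmul, lone]

theorem lmul_lone {A : ℕ → ℕ → ℝ} (hA : ∀ i j, i < j → A i j = 0) : lmul A lone = A := by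
  funext i j
  simp only [lmul, lone, mul_ite, mul_one, mul_zero, Finset.sum_ite_eq', Finset.mem_range]
  split_ifs with h
  · rfl
  · rw [hA i j (by omega)]

section Triangular

variable {S : ℕ → ℕ → ℝ}

theorem IsLowerUnitri.lmul_lowerInv (hS : IsLowerUnitri S) : lmul S (lowerInv S) = lone := by
  funext i j
  exact mul_lowerInv hS i j

theorem IsLowerUnitri.lowerInv_lowerInv (hS : IsLowerUnitri S) : lowerInv (lowerInv S) = S := by
  have hL := lowerInv_isLowerUnitri S
  rw [← lone_lmul (lowerInv (lowerInv S)), ← hS.lmul_lowerInv, lmul_assoc hL.upper,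
    hL.lmul_lowerInv, lmul_lone hS.upper]

theorem IsLowerUnitri.lowerInv_lmul (hS : IsLowerUnitri S) : lmul (lowerInv S) S = lone := by
  have h := (lowerInv_isLowerUnitri S).lmul_lowerInv
  rwa [hS.lowerInv_lowerInv] at h

theorem IsLowerUnitri.eq_lowerInv (hS : IsLowerUnitri S) {X : ℕ → ℕ → ℝ}
    (h : lmul S X = lone) : X = lowerInv S := by
  rw [← lone_lmul X, ← hS.lowerInv_lmul, lmul_assoc hS.upper, h,
    lmul_lone (lowerInv_isLowerUnitri S).upper]

/-! ### Gauss-Borel factorizations -/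

section GaussBorel
variable {g : ℕ → ℕ → ℝ} {H : ℕ → ℝ} {T : ℕ → ℕ → ℝ}

theorem IsGaussBorel.eq_lmul (h : IsGaussBorel g S H T) :
    g = lmul (lowerInv S) fun k j => H k * lowerInv T j k := by
  funext i j
  rw [h.factor]
  exact Finset.sum_congr rfl fun k _ => by ring

theorem IsGaussBorel.lmul_eq (h : IsGaussBorel g S H T) :
    lmul S g = fun k j => H k * lowerInv T j k := by
  rw [h.eq_lmul, ← lmul_assoc (lowerInv_isLowerUnitri S).upper, h.left.lmul_lowerInv, lone_lmul]

theorem IsGaussBorel.lmul_lt (h : IsGaussBorel g S H T) {n j : ℕ} (hj : j < n) :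
    lmul S g n j = 0 := by
  rw [h.lmul_eq]
  simp [(lowerInv_isLowerUnitri T).upper j n hj]

theorem IsGaussBorel.lmul_diag (h : IsGaussBorel g S H T) (n : ℕ) : lmul S g n n = H n := by
  rw [h.lmul_eq]
  simp [(lowerInv_isLowerUnitri T).diag n]

/-- Here `S g` is upper triangular with nonzero diagonal; splitting off that diagonal leaves the
transpose of a unitriangular matrix. -/
theorem isGaussBorel_of_orthogonal (hS : IsLowerUnitri S) (h0 : ∀ n j, j < n → lmul S g n j = 0)
    (h1 : ∀ n, lmul S g n n ≠ 0) :
    IsGaussBorel g S (fun n => lmul S g n n)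
      (lowerInv fun j k => lmul S g k j / lmul S g k k) := by
  have hV : IsLowerUnitri fun j k => lmul S g k j / lmul S g k k :=
    ⟨fun i => div_self (h1 i), fun i j hij => by simp [h0 j i hij]⟩
  refine ⟨hS, lowerInv_isLowerUnitri _, h1, fun i j => ?_⟩
  rw [hV.lowerInv_lowerInv]
  have h : lmul (lowerInv S) (lmul S g) i j = g i j := by
    rw [← lmul_assoc hS.upper, hS.lowerInv_lmul, lone_lmul]
  rw [← h, lmul]
  refine Finset.sum_congr rfl fun k _ => ?_
  have := h1 k
  field_simp

/-- `D = S' S⁻¹` is unitriangular and carries the upper triangular `S g`, with nonzero diagonal, to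
the upper triangular `S' g`. Solving column by column kills the entries of `D` below the diagonal.
-/
theorem IsGaussBorel.left_unique (h : IsGaussBorel g S H T) {S' : ℕ → ℕ → ℝ}
    (hS' : IsLowerUnitri S') (h0 : ∀ n j, j < n → lmul S' g n j = 0) : S = S' := by
  have hL := lowerInv_isLowerUnitri S
  have hDS : lmul (lmul S' (lowerInv S)) S = S' := by
    rw [lmul_assoc hL.upper, h.left.lowerInv_lmul, lmul_lone hS'.upper]
  have hDU : lmul (lmul S' (lowerInv S)) (lmul S g) = lmul S' g := by
    rw [← lmul_assoc h.left.upper, hDS]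
  suffices hD : lmul S' (lowerInv S) = lone by rw [← hDS, hD, lone_lmul]
  funext n p
  rcases lt_trichotomy n p with hnp | hnp | hnp
  · rw [lone, if_neg hnp.ne, lmul]
    refine Finset.sum_eq_zero fun k hk => ?_
    rw [hL.upper k p (by have := Finset.mem_range.1 hk; omega), mul_zero]
  · subst hnp
    rw [lone, if_pos rfl, lmul, Finset.sum_range_succ, hS'.diag, hL.diag, mul_one, add_eq_right]
    refine Finset.sum_eq_zero fun k hk => ?_
    rw [hL.upper k n (Finset.mem_range.1 hk), mul_zero]
  · rw [lone, if_neg hnp.ne']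
    induction p using Nat.strong_induction_on with
    | _ p ih =>
      have h1 := congrFun (congrFun hDU n) p
      rw [h0 n p hnp, lmul, Finset.sum_eq_single_of_mem p (by simp; omega)] at h1
      · rw [h.lmul_diag] at h1
        exact (mul_eq_zero.1 h1).resolve_right (h.diag_ne_zero p)
      · intro k _ hkp
        rcases lt_or_gt_of_ne hkp with hk | hk
        · rw [ih k hk (by omega), zero_mul]
        · rw [h.lmul_lt hk, mul_zero]

end GaussBorel

/-! ### The Jacobi matrix -/

theorem jacobi_eq_lmul (S : ℕ → ℕ → ℝ) :
    jacobi S = lmul S fun k m => lowerInv S (k + 1) m := rfl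

theorem jacobi_of_lt {n m : ℕ} (h : n + 1 < m) : jacobi S n m = 0 := by
  refine Finset.sum_eq_zero fun k hk => ?_
  rw [(lowerInv_isLowerUnitri S).upper _ _ (by have := Finset.mem_range.1 hk; omega), mul_zero]

theorem IsLowerUnitri.jacobi_succ (hS : IsLowerUnitri S) (n : ℕ) : jacobi S n (n + 1) = 1 := by
  have hL := lowerInv_isLowerUnitri S
  rw [jacobi, Finset.sum_range_succ, hS.diag, hL.diag, mul_one, add_eq_right]
  refine Finset.sum_eq_zero fun k hk => ?_
  rw [hL.upper _ _ (by have := Finset.mem_range.1 hk; omega), mul_zero]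

theorem IsLowerUnitri.jacobi_diag_succ (hS : IsLowerUnitri S) (n : ℕ) :
    jacobi S (n + 1) (n + 1) = lowerInv S (n + 2) (n + 1) - lowerInv S (n + 1) n := by
  have hL := lowerInv_isLowerUnitri S
  have h1 : S (n + 1) n = - lowerInv S (n + 1) n := by
    have h := mul_lowerInv hS (n + 1) n
    rw [if_neg (by omega), Finset.sum_range_succ, Finset.sum_range_succ, hS.diag, hL.diag,
      Finset.sum_eq_zero] at h
    · linarith
    · intro k hk
      rw [hL.upper _ _ (Finset.mem_range.1 hk), mul_zero]
  rw [jacobi, Finset.sum_range_succ, Finset.sum_range_succ, hS.diag, hL.diag, h1,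
    Finset.sum_eq_zero]
  · ring
  · intro k hk
    rw [hL.upper _ _ (by have := Finset.mem_range.1 hk; omega), mul_zero]

theorem IsLowerUnitri.jacobi_zero (hS : IsLowerUnitri S) :
    jacobi S 0 0 = lowerInv S 1 0 := by
  simp [jacobi, hS.diag]

theorem IsLowerUnitri.lowerInv_mul_jacobi (hS : IsLowerUnitri S) (i n : ℕ) :
    lowerInv S (i + 1) n = ∑ m ∈ Finset.range (i + 1), lowerInv S i m * jacobi S m n := by
  have h : lmul (lowerInv S) (jacobi S) = fun k m => lowerInv S (k + 1) m := by
    rw [jacobi_eq_lmul, ← lmul_assoc hS.upper, hS.lowerInv_lmul, lone_lmul]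
  exact (congrFun (congrFun h i) n).symm

/-- This is `J S = S Λ` applied to a vector; the constant vector gives the right eigenvector at 1.
-/
theorem IsLowerUnitri.sum_jacobi_mul (hS : IsLowerUnitri S) (f : ℕ → ℝ) (n : ℕ) :
    ∑ m ∈ Finset.range (n + 2), jacobi S n m * ∑ k ∈ Finset.range (m + 1), S m k * f k
      = ∑ k ∈ Finset.range (n + 1), S n k * f (k + 1) := by
  have hL := lowerInv_isLowerUnitri S
  simp only [jacobi, Finset.sum_mul]
  rw [Finset.sum_comm]
  refine Finset.sum_congr rfl fun k hk => ?_
  have hk' := Finset.mem_range.1 hk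
  have h : lmul (lowerInv S) (lmul S fun k _ => f k) (k + 1) 0 = f (k + 1) := by
    rw [← lmul_assoc hS.upper, hS.lowerInv_lmul, lone_lmul]
  rw [← h, lmul, Finset.mul_sum, ← Finset.sum_subset
    (Finset.range_mono (show k + 1 + 1 ≤ n + 2 by omega))]
  · exact Finset.sum_congr rfl fun m _ => by rw [lmul, mul_assoc]
  · intro m _ hm
    rw [hL.upper _ _ (by simpa using hm)]; ring

theorem IsLowerUnitri.sum_jacobi_mul_typeII (hS : IsLowerUnitri S) (n : ℕ) :
    ∑ m ∈ Finset.range (n + 2), jacobi S n m * typeII S m 1 = typeII S n 1 := by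
  simpa [typeII] using hS.sum_jacobi_mul (fun _ => 1) n

/-! ### The band structure of the Jacobi matrix -/

section Banded
variable {g : ℕ → ℕ → ℝ} {H : ℕ → ℝ} {T : ℕ → ℕ → ℝ}

theorem IsGaussBorel.sum_jacobi_mul_lmul (h : IsGaussBorel g S H T)
    (hg : ∀ i j, g (i + 1) j = g i (j + 2)) (n j : ℕ) :
    ∑ m ∈ Finset.range (n + 2), jacobi S n m * lmul S g m j = lmul S g n (j + 2) := by
  simp only [lmul, ← hg]
  exact h.left.sum_jacobi_mul (fun k => g k j) n

/-- By the Hankel-type symmetry `hg`, `J (S g)` is `S g` shifted by two columns. As `S g` is upper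
triangular with nonzero diagonal, the entries of a row of `J` vanish one after the other. -/
theorem IsGaussBorel.jacobi_eq_zero (h : IsGaussBorel g S H T)
    (hg : ∀ i j, g (i + 1) j = g i (j + 2)) {n j : ℕ} (hj : j + 2 < n) : jacobi S n j = 0 := by
  induction j using Nat.strong_induction_on with
  | _ j ih =>
    have h1 := h.sum_jacobi_mul_lmul hg n j
    rw [h.lmul_lt hj, Finset.sum_eq_single_of_mem j (by simp; omega)] at h1
    · rw [h.lmul_diag] at h1
      exact (mul_eq_zero.1 h1).resolve_right (h.diag_ne_zero j)
    · intro k _ hkj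
      rcases lt_or_gt_of_ne hkj with hk | hk
      · rw [ih k hk (by omega), zero_mul]
      · rw [h.lmul_lt hk, mul_zero]

theorem IsGaussBorel.jacobi_add_two (h : IsGaussBorel g S H T)
    (hg : ∀ i j, g (i + 1) j = g i (j + 2)) (n : ℕ) : jacobi S (n + 2) n = H (n + 2) / H n := by
  have h1 := h.sum_jacobi_mul_lmul hg (n + 2) n
  rw [h.lmul_diag, Finset.sum_eq_single_of_mem n (by simp; omega)] at h1
  · rw [h.lmul_diag] at h1
    exact (eq_div_iff (h.diag_ne_zero n)).2 h1
  · intro k _ hkj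
    rcases lt_or_gt_of_ne hkj with hk | hk
    · rw [h.jacobi_eq_zero hg (by omega), zero_mul]
    · rw [h.lmul_lt hk, mul_zero]

/-- The identity `g Tᵀ H⁻¹ = S⁻¹`: the moments of the type I linear forms are the entries of `S⁻¹`.
-/
theorem IsGaussBorel.sum_mul_moment (h : IsGaussBorel g S H T) (i n : ℕ) :
    (H n)⁻¹ * ∑ j ∈ Finset.range (n + 1), T n j * g i j = lowerInv S i n := by
  have h1 : ∑ j ∈ Finset.range (n + 1), T n j * g i j = lowerInv S i n * H n := by
    simp only [h.factor, Finset.mul_sum]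
    rw [Finset.sum_comm]
    have h2 : ∀ k, ∑ j ∈ Finset.range (n + 1), T n j * (lowerInv S i k * H k * lowerInv T j k)
        = lowerInv S i k * H k * if n = k then 1 else 0 := by
      intro k
      rw [← mul_lowerInv h.right, Finset.mul_sum]
      exact Finset.sum_congr rfl fun j _ => by ring
    simp only [h2, mul_ite, mul_one, mul_zero, Finset.sum_ite_eq, Finset.mem_range]
    split_ifs with hn
    · rfl
    · rw [(lowerInv_isLowerUnitri S).upper i n (by omega), zero_mul]
  rw [h1]
  have := h.diag_ne_zero n
  field_simp

end Banded

end Triangular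

/-! ### Finite differences -/

theorem sum_alternating_choose_eq_fwdDiff (f : ℝ → ℝ) (n : ℕ) :
    ∑ k ∈ Finset.range (n + 1), (-1) ^ k * (n.choose k : ℝ) * f k
      = (-1) ^ n * (fwdDiff (1 : ℝ))^[n] f 0 := by
  rw [fwdDiff_iter_eq_sum_shift, Finset.mul_sum]
  refine Finset.sum_congr rfl fun k hk => ?_
  have hk' := Finset.mem_range.1 hk
  simp only [zsmul_eq_mul, nsmul_eq_mul, mul_one, zero_add]
  push_cast
  have : (-1 : ℝ) ^ n * (-1) ^ (n - k) = (-1) ^ k := by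
    obtain ⟨r, rfl⟩ := Nat.exists_eq_add_of_le (show k ≤ n by omega)
    rw [Nat.add_sub_cancel_left, pow_add, mul_assoc, ← pow_add, ← two_mul, pow_mul]
    simp
  rw [← this]; ring

theorem sum_alternating_choose_mul_eval {p : Polynomial ℝ} {n : ℕ} (hp : p.natDegree < n) :
    ∑ k ∈ Finset.range (n + 1), (-1) ^ k * (n.choose k : ℝ) * p.eval (k : ℝ) = 0 := by
  rw [sum_alternating_choose_eq_fwdDiff (fun x => p.eval x),
    Polynomial.fwdDiff_iter_eq_zero_of_degree_lt hp]
  simp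

theorem sum_alternating_choose_div {e : ℝ} (he : 0 < e) (n : ℕ) :
    ∑ k ∈ Finset.range (n + 1), (-1) ^ k * (n.choose k : ℝ) * (1 / (k + e))
      = n.factorial / poch e (n + 1) := by
  have key : ∀ n : ℕ, ∀ y : ℝ, 0 ≤ y → (fwdDiff (1 : ℝ))^[n] (fun x : ℝ => 1 / (x + e)) y
      = (-1) ^ n * n.factorial / poch (y + e) (n + 1) := by
    intro n
    induction n with
    | zero => intro y hy; simp [poch]
    | succ n ih =>
      intro y hy
      rw [Function.iterate_succ_apply', fwdDiff, ih _ (by linarith), ih y hy,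
        poch_succ (y + 1 + e), poch_succ (y + e) (n + 1), poch_succ' (y + e) n,
        show y + 1 + e = y + e + 1 by ring]
      have h1 : y + e ≠ 0 := by positivity
      have h2 : y + e + 1 + n ≠ 0 := by positivity
      have h3 := poch_ne_zero (show 0 < y + e + 1 by positivity) n
      have h4 : y + e + (n + 1 : ℕ) = y + e + 1 + n := by push_cast; ring
      rw [h4]
      simp only [Nat.factorial_succ, Nat.cast_mul, Nat.cast_add, Nat.cast_one, pow_succ]
      field_simp
      ring
  rw [sum_alternating_choose_eq_fwdDiff (fun x : ℝ => 1 / (x + e)), key n 0 le_rfl, zero_add,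
    ← mul_div_assoc, ← mul_assoc, ← mul_pow]
  simp

/-- Divide `p` by `X + e`: the quotient has degree below `n` and is annihilated by the `n`-th
difference, so only the remainder `p(-e)` over `k + e` counts. -/
theorem sum_alternating_choose_mul_eval_div {p : Polynomial ℝ} {n : ℕ} (hp : p.natDegree ≤ n)
    {e : ℝ} (he : 0 < e) :
    ∑ k ∈ Finset.range (n + 1), (-1) ^ k * (n.choose k : ℝ) * (p.eval (k : ℝ) / (k + e))
      = p.eval (-e) * (n.factorial / poch e (n + 1)) := by
  set q := p.divByMonic (Polynomial.X - Polynomial.C (-e)) with hq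
  have hpq : ∀ x, p.eval x = p.eval (-e) + (x + e) * q.eval x := by
    intro x
    conv_lhs => rw [← Polynomial.modByMonic_add_div p (Polynomial.X - Polynomial.C (-e)),
      Polynomial.modByMonic_X_sub_C_eq_C_eval]
    simp [hq]
  have hterm : ∀ k : ℕ, (-1) ^ k * (n.choose k : ℝ) * (p.eval (k : ℝ) / (k + e))
      = p.eval (-e) * ((-1) ^ k * (n.choose k : ℝ) * (1 / (k + e)))
        + (-1) ^ k * (n.choose k : ℝ) * q.eval (k : ℝ) := by
    intro k
    have : (k : ℝ) + e ≠ 0 := by positivity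
    rw [hpq k]; field_simp
  simp only [hterm]
  rw [Finset.sum_add_distrib, ← Finset.mul_sum, sum_alternating_choose_div he]
  -- For `n = 0` no `natDegree` is below `n`; there `p` is constant and the quotient is 0.
  rcases Nat.eq_zero_or_pos n with rfl | hn
  · have : q = 0 := by
      rw [hq, Polynomial.divByMonic_eq_zero_iff (Polynomial.monic_X_sub_C _)]
      rw [Polynomial.degree_X_sub_C]
      exact (Polynomial.degree_le_of_natDegree_le hp).trans_lt (by norm_num)
    simp [this]
  · rw [sum_alternating_choose_mul_eval (p := q), add_zero]
    rw [hq, Polynomial.natDegree_divByMonic _ (Polynomial.monic_X_sub_C _),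
      Polynomial.natDegree_X_sub_C]
    omega

/-! ### The hypergeometric type II polynomials -/

theorem poch_reflect (y : ℝ) (n : ℕ) : poch (1 - y - n) n = (-1) ^ n * poch y n := by
  induction n with
  | zero => simp
  | succ n ih =>
    rw [poch_succ', show 1 - y - (n + 1 : ℕ) + 1 = 1 - y - n by push_cast; ring, ih, poch_succ]
    push_cast; ring

/-- The polynomial `X ↦ (x + X)_n`. -/
def pochPoly (x : ℝ) (n : ℕ) : Polynomial ℝ :=
  ∏ i ∈ Finset.range n, (Polynomial.X + Polynomial.C (x + i))

@[simp] theorem eval_pochPoly (x y : ℝ) (n : ℕ) : (pochPoly x n).eval y = poch (x + y) n := by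
  simp only [pochPoly, Polynomial.eval_prod, poch]
  refine Finset.prod_congr rfl fun i _ => ?_
  simp; ring

theorem natDegree_pochPoly (x : ℝ) (n : ℕ) : (pochPoly x n).natDegree = n := by
  rw [pochPoly, Polynomial.natDegree_prod_of_monic _ _ fun i _ => Polynomial.monic_X_add_C _]
  simp only [Polynomial.natDegree_X_add_C, Finset.sum_const, Finset.card_range, smul_eq_mul, mul_one]

/-- As a function of `k` this quotient is a polynomial of degree `m - i`; for `i = m + 1`, treated
next, it has a simple pole. -/
theorem poch_div_poch {x : ℝ} (hx : 0 < x) (k : ℕ) {m i : ℕ} (h : i ≤ m) :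
    poch (x + m) k / poch x (k + i) = (poch x m)⁻¹ * poch (x + i + k) (m - i) := by
  have h1 : poch x m * poch (x + m) k = poch x (k + i) * poch (x + i + k) (m - i) := by
    rw [← poch_add, show m + k = (k + i) + (m - i) by omega, poch_add]
    push_cast
    ring_nf
  have h2 := poch_ne_zero hx m
  have h3 := poch_ne_zero hx (k + i)
  rw [div_eq_iff h3]
  field_simp
  linarith

theorem poch_div_poch_succ {x : ℝ} (hx : 0 < x) (k m : ℕ) :
    poch (x + m) k / poch x (k + (m + 1)) = (poch x m)⁻¹ / (k + (x + m)) := by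
  have h1 : poch x (k + (m + 1)) = poch x m * poch (x + m) k * (k + (x + m)) := by
    rw [← poch_add, show k + (m + 1) = m + k + 1 by omega, poch_succ]
    push_cast; ring
  have h2 := poch_ne_zero hx m
  have h3 := poch_ne_zero (show 0 < x + m by positivity) k
  have h4 : (k : ℝ) + (x + m) ≠ 0 := by positivity
  rw [h1]
  field_simp

theorem poch_add_div_poch {x : ℝ} (hx : 0 < x) (k i : ℕ) :
    poch x (k + i) / poch x k = poch (x + k) i := by
  rw [poch_add, mul_div_cancel_left₀ _ (poch_ne_zero hx k)]

/-- The normalization making the type II polynomials monic. -/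
def typeIINorm (a b c d : ℝ) (n : ℕ) : ℝ :=
  (-1) ^ n * (poch a n * poch b n / (poch (c + (n / 2 : ℕ)) n * poch (d + ((n - 1) / 2 : ℕ)) n))

/-- The coefficients of the hypergeometric type II polynomials
`₃F₂(-n, c + ⌊n / 2⌋, d + ⌊(n - 1) / 2⌋; a, b; x)`, made monic. -/
def typeIICoeff (a b c d : ℝ) (n k : ℕ) : ℝ :=
  typeIINorm a b c d n * ((-1) ^ k * (n.choose k : ℝ) *
    (poch (c + (n / 2 : ℕ)) k * poch (d + ((n - 1) / 2 : ℕ)) k / (poch a k * poch b k)))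

/-- The common form of the moments and of the entries of the inverse of the matrix of
type II coefficients. -/
def shiftedRatio (a b c d : ℝ) (i₁ i₂ i₃ i₄ k : ℕ) : ℝ :=
  poch a (k + i₁) * poch b (k + i₂) / (poch c (k + i₃) * poch d (k + i₄))

namespace Admissible
variable {a b c d : ℝ}

theorem isLowerUnitri_typeIICoeff (h : Admissible a b c d) :
    IsLowerUnitri (typeIICoeff a b c d) where
  diag n := by
    have h1 := poch_ne_zero h.a_pos n
    have h2 := poch_ne_zero h.b_pos n
    have h3 := poch_ne_zero (show 0 < c + (n / 2 : ℕ) by have := h.c_pos; positivity) n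
    have h4 := poch_ne_zero (show 0 < d + ((n - 1) / 2 : ℕ) by have := h.d_pos; positivity) n
    have h5 : (-1 : ℝ) ^ n * (-1) ^ n = 1 := by rw [← mul_pow]; simp
    rw [typeIICoeff, typeIINorm, Nat.choose_self]
    field_simp
    simp [← pow_mul]
  upper n k hk := by simp [typeIICoeff, Nat.choose_eq_zero_of_lt hk]

/-- All Pochhammer quotients reduce to polynomials in `k`, and `hdeg` bounds their total degree
below `n`, so the `n`-th difference vanishes. This serves both the orthogonality relations and the
inversion of the coefficient matrix. -/
theorem sum_typeIICoeff_mul (h : Admissible a b c d) (r : Polynomial ℝ)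
    {n i₁ i₂ i₃ i₄ : ℕ} (h₃ : i₃ ≤ n / 2) (h₄ : i₄ ≤ (n - 1) / 2)
    (hdeg : r.natDegree + i₁ + i₂ + n / 2 + (n - 1) / 2 < n + i₃ + i₄) :
    ∑ k ∈ Finset.range (n + 1), typeIICoeff a b c d n k *
      (r.eval (k : ℝ) * shiftedRatio a b c d i₁ i₂ i₃ i₄ k) = 0 := by
  set p : Polynomial ℝ := r * pochPoly a i₁ * pochPoly b i₂ *
    pochPoly (c + i₃) (n / 2 - i₃) * pochPoly (d + i₄) ((n - 1) / 2 - i₄) with hp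
  have hpdeg : p.natDegree < n := by
    have : p.natDegree ≤ r.natDegree + i₁ + i₂ + (n / 2 - i₃) + ((n - 1) / 2 - i₄) := by
      simp only [hp]
      refine Polynomial.natDegree_mul_le_of_le (Polynomial.natDegree_mul_le_of_le
        (Polynomial.natDegree_mul_le_of_le (Polynomial.natDegree_mul_le_of_le le_rfl ?_) ?_) ?_) ?_
      all_goals rw [natDegree_pochPoly]
    omega
  have hterm : ∀ k : ℕ, typeIICoeff a b c d n k *
      (r.eval (k : ℝ) * shiftedRatio a b c d i₁ i₂ i₃ i₄ k)
      = typeIINorm a b c d n * ((poch c (n / 2))⁻¹ * (poch d ((n - 1) / 2))⁻¹) *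
        ((-1) ^ k * (n.choose k : ℝ) * p.eval (k : ℝ)) := by
    intro k
    have e : typeIICoeff a b c d n k * (r.eval (k : ℝ) * shiftedRatio a b c d i₁ i₂ i₃ i₄ k)
        = typeIINorm a b c d n * ((-1) ^ k * (n.choose k : ℝ)) * (r.eval (k : ℝ) *
          (poch a (k + i₁) / poch a k) * (poch b (k + i₂) / poch b k) *
          (poch (c + (n / 2 : ℕ)) k / poch c (k + i₃)) *
          (poch (d + ((n - 1) / 2 : ℕ)) k / poch d (k + i₄))) := by
      rw [typeIICoeff, shiftedRatio]
      simp only [div_eq_mul_inv, mul_inv]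
      ring
    rw [e, poch_add_div_poch h.a_pos, poch_add_div_poch h.b_pos, poch_div_poch h.c_pos k h₃,
      poch_div_poch h.d_pos k h₄]
    simp only [hp, Polynomial.eval_mul, eval_pochPoly]
    ring
  simp only [hterm]
  rw [← Finset.mul_sum, sum_alternating_choose_mul_eval hpdeg, mul_zero]

theorem pochRatio_add (i j : ℕ) :
    pochRatio a b c d (i + j) = shiftedRatio a b c d j j j j i := rfl

theorem pochRatio_succ_add (h : Admissible a b c d) (i j : ℕ) :
    pochRatio a (b + 1) (c + 1) d (i + j) = c / b * shiftedRatio a b c d j (j + 1) (j + 1) j i := by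
  have hb := h.b_pos
  have hc := h.c_pos
  rw [pochRatio, shiftedRatio, ← add_assoc, poch_succ' b, poch_succ' c]
  have h1 := poch_ne_zero (show 0 < c + 1 by linarith) (i + j)
  have h2 := poch_ne_zero h.d_pos (i + j)
  field_simp

theorem lmul_typeIICoeff_moment (h : Admissible a b c d) {n j : ℕ} (hj : j < n) :
    lmul (typeIICoeff a b c d) (moment a b c d) n j = 0 := by
  rw [lmul]
  obtain ⟨i, rfl | rfl⟩ := Nat.even_or_odd' j
  · simp only [h.moment_even, pochRatio_add]
    have := h.sum_typeIICoeff_mul 1 (n := n) (i₁ := i) (i₂ := i) (i₃ := i) (i₄ := i)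
      (by omega) (by omega) (by simp; omega)
    simpa using this
  · simp only [h.moment_odd, h.pochRatio_succ_add]
    have := h.sum_typeIICoeff_mul (Polynomial.C (c / b)) (n := n) (i₁ := i) (i₂ := i + 1)
      (i₃ := i + 1) (i₄ := i) (by omega) (by omega) (by simp; omega)
    simpa using this

theorem lmul_moment_zero (h : Admissible a b c d) :
    lmul (typeIICoeff a b c d) (moment a b c d) 0 0 = 1 := by
  have := h.moment_even 0 0
  rw [mul_zero] at this
  simp [lmul, this, pochRatio, h.isLowerUnitri_typeIICoeff.diag]

/-- On the diagonal the shift of `d` exceeds `(n - 1) / 2` by one, which leaves a simple pole at `k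
= -(d + j)`; reflecting the numerator there produces `d - a` and `d - b`. At odd indices `c` takes
the role of `d`. -/
theorem lmul_moment_even (h : Admissible a b c d) (j : ℕ) :
    lmul (typeIICoeff a b c d) (moment a b c d) (2 * j + 2) (2 * j + 2)
      = poch a (2 * j + 2) * poch b (2 * j + 2) * (2 * j + 2).factorial * poch (d - a) (j + 1) *
        poch (d - b) (j + 1) /
        (poch c (3 * j + 3) * poch d (3 * j + 2) * poch (d + j) (2 * j + 3)) := by
  have hc := h.c_pos
  have hd := h.d_pos
  set n := 2 * j + 2 with hn
  have e1 : n / 2 = j + 1 := by omega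
  have e2 : (n - 1) / 2 = j := by omega
  set p : Polynomial ℝ := pochPoly a (j + 1) * pochPoly b (j + 1) with hp
  have hpdeg : p.natDegree ≤ n := by
    refine (Polynomial.natDegree_mul_le).trans ?_
    rw [natDegree_pochPoly, natDegree_pochPoly]; omega
  have hterm : ∀ k : ℕ, typeIICoeff a b c d n k * moment a b c d k n
      = typeIINorm a b c d n * ((poch c (j + 1))⁻¹ * (poch d j)⁻¹) *
        ((-1) ^ k * (n.choose k : ℝ) * (p.eval (k : ℝ) / (k + (d + j)))) := by
    intro k
    rw [show n = 2 * (j + 1) by omega, h.moment_even, ← show n = 2 * (j + 1) by omega]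
    have e : typeIICoeff a b c d n k * pochRatio a b c d (k + (j + 1))
        = typeIINorm a b c d n * ((-1) ^ k * (n.choose k : ℝ)) * (
          (poch a (k + (j + 1)) / poch a k) * (poch b (k + (j + 1)) / poch b k) *
          (poch (c + (j + 1 : ℕ)) k / poch c (k + (j + 1))) *
          (poch (d + j) k / poch d (k + (j + 1)))) := by
      rw [typeIICoeff, pochRatio, e1, e2]
      simp only [div_eq_mul_inv, mul_inv]
      ring
    rw [e, poch_add_div_poch h.a_pos, poch_add_div_poch h.b_pos, poch_div_poch h.c_pos k le_rfl,
      poch_div_poch_succ h.d_pos]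
    simp only [hp, Polynomial.eval_mul, eval_pochPoly, Nat.sub_self, poch_zero]
    ring
  rw [lmul]
  simp only [hterm]
  rw [← Finset.mul_sum, sum_alternating_choose_mul_eval_div hpdeg (by positivity)]
  have r1 : poch (a + -(d + j)) (j + 1) = (-1) ^ (j + 1) * poch (d - a) (j + 1) := by
    rw [← poch_reflect]; congr 1; push_cast; ring
  have r2 : poch (b + -(d + j)) (j + 1) = (-1) ^ (j + 1) * poch (d - b) (j + 1) := by
    rw [← poch_reflect]; congr 1; push_cast; ring
  have r3 : (-1 : ℝ) ^ (j + 1) * (-1) ^ (j + 1) = 1 := by rw [← mul_pow]; simp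
  have r4 : (-1 : ℝ) ^ n = 1 := by rw [hn, show 2 * j + 2 = 2 * (j + 1) by ring, pow_mul]; simp
  have q1 : poch c (3 * j + 3) = poch c (j + 1) * poch (c + (j + 1 : ℕ)) n := by
    rw [← poch_add]; congr 1; omega
  have q2 : poch d (3 * j + 2) = poch d j * poch (d + j) n := by
    rw [← poch_add]; congr 1; omega
  simp only [hp, Polynomial.eval_mul, eval_pochPoly, typeIINorm, e1, e2]
  rw [r1, r2, r4, q1, q2]
  simp only [div_eq_mul_inv, mul_inv]
  linear_combination (poch (d - a) (j + 1) * poch (d - b) (j + 1) * poch a n * poch b n *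
    (poch (c + (j + 1 : ℕ)) n)⁻¹ * (poch (d + j) n)⁻¹ * (poch c (j + 1))⁻¹ * (poch d j)⁻¹ *
    n.factorial * (poch (d + j) (n + 1))⁻¹) * r3

theorem lmul_moment_odd (h : Admissible a b c d) (j : ℕ) :
    lmul (typeIICoeff a b c d) (moment a b c d) (2 * j + 1) (2 * j + 1)
      = c / b * (poch a (2 * j + 1) * poch b (2 * j + 1) * (2 * j + 1).factorial *
        poch (c - a + 1) j * poch (c - b) (j + 1)) /
        (poch c (3 * j + 1) * poch d (3 * j + 1) * poch (c + j) (2 * j + 2)) := by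
  have hc := h.c_pos
  have hd := h.d_pos
  set n := 2 * j + 1 with hn
  have e1 : n / 2 = j := by omega
  have e2 : (n - 1) / 2 = j := by omega
  set p : Polynomial ℝ := pochPoly a j * pochPoly b (j + 1) with hp
  have hpdeg : p.natDegree ≤ n := by
    refine (Polynomial.natDegree_mul_le).trans ?_
    rw [natDegree_pochPoly, natDegree_pochPoly]; omega
  have hterm : ∀ k : ℕ, typeIICoeff a b c d n k * moment a b c d k n
      = c / b * typeIINorm a b c d n * ((poch c j)⁻¹ * (poch d j)⁻¹) *
        ((-1) ^ k * (n.choose k : ℝ) * (p.eval (k : ℝ) / (k + (c + j)))) := by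
    intro k
    rw [hn, h.moment_odd, ← hn, h.pochRatio_succ_add]
    have e : typeIICoeff a b c d n k * (c / b * shiftedRatio a b c d j (j + 1) (j + 1) j k)
        = c / b * typeIINorm a b c d n * ((-1) ^ k * (n.choose k : ℝ)) * (
          (poch a (k + j) / poch a k) * (poch b (k + (j + 1)) / poch b k) *
          (poch (c + j) k / poch c (k + (j + 1))) *
          (poch (d + j) k / poch d (k + j))) := by
      rw [typeIICoeff, shiftedRatio, e1, e2]
      simp only [div_eq_mul_inv, mul_inv]
      ring
    rw [e, poch_add_div_poch h.a_pos, poch_add_div_poch h.b_pos, poch_div_poch h.d_pos k le_rfl,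
      poch_div_poch_succ h.c_pos]
    simp only [hp, Polynomial.eval_mul, eval_pochPoly, Nat.sub_self, poch_zero]
    ring
  rw [lmul]
  simp only [hterm]
  rw [← Finset.mul_sum, sum_alternating_choose_mul_eval_div hpdeg (by positivity)]
  have r1 : poch (a + -(c + j)) j = (-1) ^ j * poch (c - a + 1) j := by
    rw [← poch_reflect]; congr 1; ring
  have r2 : poch (b + -(c + j)) (j + 1) = (-1) ^ (j + 1) * poch (c - b) (j + 1) := by
    rw [← poch_reflect]; congr 1; push_cast; ring
  have r3 : (-1 : ℝ) ^ n * ((-1) ^ j * (-1) ^ (j + 1)) = 1 := by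
    rw [← pow_add, ← pow_add, show n + (j + (j + 1)) = 2 * n by omega, pow_mul]; simp
  have q1 : poch c (3 * j + 1) = poch c j * poch (c + j) n := by
    rw [← poch_add]; congr 1; omega
  have q2 : poch d (3 * j + 1) = poch d j * poch (d + j) n := by
    rw [← poch_add]; congr 1; omega
  simp only [hp, Polynomial.eval_mul, eval_pochPoly, typeIINorm, e1, e2]
  rw [r1, r2, q1, q2]
  simp only [div_eq_mul_inv, mul_inv]
  linear_combination (poch (c - a + 1) j * poch (c - b) (j + 1) * poch a n * poch b n *
    (poch (c + j) n)⁻¹ * (poch (d + j) n)⁻¹ * (poch c j)⁻¹ * (poch d j)⁻¹ *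
    n.factorial * (poch (c + j) (n + 1))⁻¹ * (c * b⁻¹)) * r3

theorem poch_sub_ne_zero (h : Admissible a b c d) (n : ℕ) : poch (c - b) n ≠ 0 := by
  refine Finset.prod_ne_zero_iff.2 fun i _ => ?_
  rcases i with _ | i
  · simpa using sub_ne_zero.2 h.c_ne_b
  · have := h.b_lt_c
    have : 0 < c - b + (i + 1 : ℕ) := by push_cast; linarith [(Nat.cast_nonneg i : (0 : ℝ) ≤ i)]
    exact this.ne'

theorem lmul_moment_ne_zero (h : Admissible a b c d) (n : ℕ) :
    lmul (typeIICoeff a b c d) (moment a b c d) n n ≠ 0 := by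
  have hc := h.c_pos
  have hd := h.d_pos
  obtain ⟨j, rfl | rfl⟩ := Nat.even_or_odd' n
  · rcases j with _ | j
    · rw [mul_zero, h.lmul_moment_zero]; norm_num
    · rw [show 2 * (j + 1) = 2 * j + 2 by ring, h.lmul_moment_even]
      have h1 := poch_pos h.a_pos (2 * j + 2)
      have h2 := poch_pos h.b_pos (2 * j + 2)
      have h3 := poch_pos (sub_pos.2 h.a_lt_d) (j + 1)
      have h4 := poch_pos (sub_pos.2 h.b_lt_d) (j + 1)
      have h5 := poch_pos hc (3 * j + 3)
      have h6 := poch_pos hd (3 * j + 2)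
      have h7 := poch_pos (show 0 < d + j by positivity) (2 * j + 3)
      positivity
  · rw [h.lmul_moment_odd]
    have h1 := poch_ne_zero h.a_pos (2 * j + 1)
    have h2 := poch_ne_zero h.b_pos (2 * j + 1)
    have h3 := poch_ne_zero (show 0 < c - a + 1 by linarith [h.a_le_c]) j
    have h4 := h.poch_sub_ne_zero (j + 1)
    have h5 := poch_ne_zero hc (3 * j + 1)
    have h6 := poch_ne_zero hd (3 * j + 1)
    have h7 := poch_ne_zero (show 0 < c + j by positivity) (2 * j + 2)
    have h8 := h.b_pos.ne'
    have h9 : ((2 * j + 1).factorial : ℝ) ≠ 0 := by positivity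
    exact div_ne_zero (mul_ne_zero (div_ne_zero hc.ne' h8) (by simp only [ne_eq, mul_eq_zero]; tauto))
      (by simp only [ne_eq, mul_eq_zero]; tauto)

theorem exists_isGaussBorel (h : Admissible a b c d) :
    ∃ S H T, IsGaussBorel (moment a b c d) S H T :=
  ⟨_, _, _, isGaussBorel_of_orthogonal h.isLowerUnitri_typeIICoeff
    (fun _ _ => h.lmul_typeIICoeff_moment) h.lmul_moment_ne_zero⟩

theorem eq_typeIICoeff (h : Admissible a b c d) {S : ℕ → ℕ → ℝ} {H : ℕ → ℝ} {T : ℕ → ℕ → ℝ}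
    (hG : IsGaussBorel (moment a b c d) S H T) : S = typeIICoeff a b c d :=
  hG.left_unique h.isLowerUnitri_typeIICoeff fun _ _ => h.lmul_typeIICoeff_moment

end Admissible

/-! ### The inverse of the matrix of type II coefficients -/

/-- The values at `1` of the type I linear forms. -/
def linFormOne (a b c d : ℝ) (n : ℕ) : ℝ :=
  poch c (n + (n + 1) / 2) * poch d (n + n / 2) / (n.factorial * (poch a n * poch b n))

/-- The entries of the inverse of the matrix of type II coefficients. -/
def typeIIInv (a b c d : ℝ) (k j : ℕ) : ℝ :=
  linFormOne a b c d j * (k.descFactorial j * shiftedRatio a b c d 0 0 ((j + 1) / 2) (j / 2) k)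

namespace Admissible
variable {a b c d : ℝ}

theorem linFormOne_pos (h : Admissible a b c d) (n : ℕ) : 0 < linFormOne a b c d n := by
  have h1 := poch_pos h.a_pos n
  have h2 := poch_pos h.b_pos n
  have h3 := poch_pos h.c_pos (n + (n + 1) / 2)
  have h4 := poch_pos h.d_pos (n + n / 2)
  rw [linFormOne]
  positivity

theorem typeIIInv_self (h : Admissible a b c d) (n : ℕ) : typeIIInv a b c d n n = 1 := by
  have h1 := poch_ne_zero h.a_pos n
  have h2 := poch_ne_zero h.b_pos n
  have h3 := poch_ne_zero h.c_pos (n + (n + 1) / 2)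
  have h4 := poch_ne_zero h.d_pos (n + n / 2)
  have h5 : (n.factorial : ℝ) ≠ 0 := by positivity
  rw [typeIIInv, linFormOne, shiftedRatio, Nat.descFactorial_self, add_zero]
  field_simp

/-- Below the diagonal, `k.descFactorial j` adds degree `j` while the shifts of `c` and `d` remove
`⌈j/2⌉ + ⌊j/2⌋ = j`, so the total degree is again `n - 1`. -/
theorem lowerInv_typeIICoeff (h : Admissible a b c d) :
    lowerInv (typeIICoeff a b c d) = typeIIInv a b c d := by
  refine (h.isLowerUnitri_typeIICoeff.eq_lowerInv ?_).symm
  funext n j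
  rw [lone, lmul]
  rcases lt_trichotomy n j with hnj | rfl | hnj
  · rw [if_neg hnj.ne]
    refine Finset.sum_eq_zero fun k hk => ?_
    rw [typeIIInv, Nat.descFactorial_of_lt (by have := Finset.mem_range.1 hk; omega)]
    simp
  · rw [if_pos rfl, Finset.sum_range_succ, h.isLowerUnitri_typeIICoeff.diag, h.typeIIInv_self,
      mul_one, add_eq_right]
    refine Finset.sum_eq_zero fun k hk => ?_
    rw [typeIIInv, Nat.descFactorial_of_lt (Finset.mem_range.1 hk)]
    simp
  · rw [if_neg hnj.ne']
    have := h.sum_typeIICoeff_mul (Polynomial.C (linFormOne a b c d j) * descPochhammer ℝ j)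
      (n := n) (i₁ := 0) (i₂ := 0) (i₃ := (j + 1) / 2) (i₄ := j / 2) (by omega) (by omega) (by
        have := Polynomial.natDegree_C_mul_le (linFormOne a b c d j) (descPochhammer ℝ j)
        rw [descPochhammer_natDegree] at this
        omega)
    rw [← this]
    refine Finset.sum_congr rfl fun k _ => ?_
    rw [typeIIInv, Polynomial.eval_mul, Polynomial.eval_C, descPochhammer_eval_eq_descFactorial]
    ring

end Admissible

/-! ### The type I linear forms at `1` -/

theorem tendsto_linear_div_linear (x y p : ℝ) {q : ℝ} (hq : q ≠ 0) :
    Tendsto (fun i : ℕ => (x + p * i) / (y + q * i)) atTop (𝓝 (p / q)) := by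
  have ht : Tendsto (fun i : ℕ => (i : ℝ)⁻¹) atTop (𝓝 0) := tendsto_inv_atTop_nhds_zero_nat
  have h := ((ht.const_mul x).add_const p).div ((ht.const_mul y).add_const q) (by simpa using hq)
  simp only [mul_zero, zero_add] at h
  refine h.congr' ?_
  filter_upwards [eventually_gt_atTop 0] with i hi
  have hi' : (i : ℝ) ≠ 0 := by exact_mod_cast hi.ne'
  have e1 : x + p * i = (x * (i : ℝ)⁻¹ + p) * i := by field_simp
  have e2 : y + q * i = (y * (i : ℝ)⁻¹ + q) * i := by field_simp
  rw [Pi.div_apply, e1, e2, mul_div_mul_right _ _ hi']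

theorem tendsto_add_nat_div (x : ℝ) : Tendsto (fun i : ℕ => (x + i) / i) atTop (𝓝 1) := by
  simpa using tendsto_linear_div_linear x 0 1 one_ne_zero

theorem tendsto_poch_div_pow (x : ℝ) (p : ℕ) :
    Tendsto (fun i : ℕ => poch (x + i) p / (i : ℝ) ^ p) atTop (𝓝 1) := by
  induction p with
  | zero => simp
  | succ p ih =>
    have h := ih.mul (tendsto_add_nat_div (x + p))
    rw [one_mul] at h
    refine h.congr fun i => ?_
    rw [div_mul_div_comm, poch_succ, pow_succ]
    ring_nf

theorem tendsto_descFactorial_div_pow (p : ℕ) :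
    Tendsto (fun i : ℕ => (i.descFactorial p : ℝ) / (i : ℝ) ^ p) atTop (𝓝 1) := by
  induction p with
  | zero => simp
  | succ p ih =>
    have h := ih.mul (tendsto_add_nat_div (-(p : ℝ)))
    rw [one_mul] at h
    refine h.congr' ?_
    filter_upwards [eventually_ge_atTop p] with i hi
    rw [div_mul_div_comm, Nat.descFactorial_succ, pow_succ, Nat.cast_mul, Nat.cast_sub hi]
    ring_nf

namespace Admissible
variable {a b c d : ℝ}

theorem pochRatio_pos (h : Admissible a b c d) (i : ℕ) : 0 < pochRatio a b c d i := by
  have h1 := poch_pos h.a_pos i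
  have h2 := poch_pos h.b_pos i
  have h3 := poch_pos h.c_pos i
  have h4 := poch_pos h.d_pos i
  rw [pochRatio]
  positivity

theorem tendsto_pochRatio_div (h : Admissible a b c d) (j : ℕ) :
    Tendsto (fun i => pochRatio a b c d (i + j) / pochRatio a b c d i) atTop (𝓝 1) := by
  have h1 := ((tendsto_poch_div_pow a j).mul (tendsto_poch_div_pow b j)).div
    ((tendsto_poch_div_pow c j).mul (tendsto_poch_div_pow d j)) (by norm_num)
  simp only [mul_one, div_one] at h1
  refine h1.congr' ?_
  filter_upwards [eventually_gt_atTop 0] with i hi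
  have hi' : (i : ℝ) ^ j ≠ 0 := pow_ne_zero _ (by exact_mod_cast hi.ne')
  have g1 := poch_ne_zero h.a_pos i
  have g2 := poch_ne_zero h.b_pos i
  have g3 := poch_ne_zero h.c_pos i
  have g4 := poch_ne_zero h.d_pos i
  have g5 := poch_ne_zero (show 0 < c + i by have := h.c_pos; positivity) j
  have g6 := poch_ne_zero (show 0 < d + i by have := h.d_pos; positivity) j
  simp only [Pi.div_apply, pochRatio, poch_add]
  field_simp

/-- High moments concentrate at `x = 1`, and `w₁` equals 1 there. The proof only uses the Pochhammer
form of the moments. -/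
theorem tendsto_moment_div (h : Admissible a b c d) (j : ℕ) :
    Tendsto (fun i => moment a b c d i j / pochRatio a b c d i) atTop (𝓝 (xi a b c d j 1)) := by
  have hw1 : w₁ a b c d 1 = 1 := by simp [w₁]
  have hw2 : w₂ a b c d 1 = c / b := by simp [w₂]
  obtain ⟨k, rfl | rfl⟩ := Nat.even_or_odd' j
  · have h1 : ¬ Odd (2 * k) := by simp
    simp only [xi, X₁, X₂, even_two_mul, if_true, h1, if_false, one_pow, hw1, h.moment_even]
    simpa using h.tendsto_pochRatio_div k
  · have h1 : ¬ Even (2 * k + 1) := by simp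
    have h2 : Odd (2 * k + 1) := ⟨k, rfl⟩
    simp only [xi, X₁, X₂, h1, h2, if_true, if_false, one_pow, hw2, h.moment_odd]
    have h3 := ((h.tendsto_pochRatio_div k).mul
      (tendsto_linear_div_linear (b + k) (c + k) 1 one_ne_zero)).const_mul (c / b)
    simp only [one_mul, div_one, mul_one, zero_mul, zero_add] at h3 ⊢
    refine h3.congr fun i => ?_
    rw [h.pochRatio_succ_add, shiftedRatio, ← add_assoc, poch_succ b, poch_succ c, pochRatio]
    have g1 : c + k + i ≠ 0 := by have := h.c_pos; positivity
    have g2 : c + (i + k : ℕ) ≠ 0 := by have := h.c_pos; positivity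
    have g3 := h.b_pos.ne'
    have e1 : b + (i + k : ℕ) = b + k + i := by push_cast; ring
    have e2 : c + (i + k : ℕ) = c + k + i := by push_cast; ring
    rw [e1, e2]
    simp only [div_eq_mul_inv, mul_inv]
    ring

theorem tendsto_typeIIInv_div (h : Admissible a b c d) (n : ℕ) :
    Tendsto (fun i => typeIIInv a b c d i n / pochRatio a b c d i) atTop
      (𝓝 (linFormOne a b c d n)) := by
  have h1 := (((tendsto_descFactorial_div_pow n)).div
    ((tendsto_poch_div_pow c ((n + 1) / 2)).mul (tendsto_poch_div_pow d (n / 2)))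
    (by norm_num)).const_mul (linFormOne a b c d n)
  simp only [mul_one, div_one] at h1
  refine h1.congr' ?_
  filter_upwards [eventually_gt_atTop 0] with i hi
  have hi0 : (i : ℝ) ≠ 0 := by exact_mod_cast hi.ne'
  have e : (i : ℝ) ^ n = i ^ ((n + 1) / 2) * i ^ (n / 2) := by
    rw [← pow_add]; congr 1; omega
  have g1 := poch_ne_zero h.a_pos i
  have g2 := poch_ne_zero h.b_pos i
  have g3 := poch_ne_zero h.c_pos i
  have g4 := poch_ne_zero h.d_pos i
  have g5 := poch_ne_zero (show 0 < c + i by have := h.c_pos; positivity) ((n + 1) / 2)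
  have g6 := poch_ne_zero (show 0 < d + i by have := h.d_pos; positivity) (n / 2)
  simp only [Pi.div_apply, typeIIInv, shiftedRatio, pochRatio, poch_add, e, poch_zero, mul_one]
  field_simp

section
variable {S : ℕ → ℕ → ℝ} {H : ℕ → ℝ} {T : ℕ → ℕ → ℝ}

/-- Two evaluations of one limit: the normalized `i`-th moment of the linear form tends to its value
at 1, and it is also an entry of the explicit inverse of `S`. -/
theorem linForm_one (h : Admissible a b c d) (hG : IsGaussBorel (moment a b c d) S H T) (n : ℕ) :
    linForm a b c d H T n 1 = linFormOne a b c d n := by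
  have h1 : Tendsto (fun i => (H n)⁻¹ * ∑ j ∈ Finset.range (n + 1),
      T n j * (moment a b c d i j / pochRatio a b c d i)) atTop
      (𝓝 ((H n)⁻¹ * ∑ j ∈ Finset.range (n + 1), T n j * xi a b c d j 1)) :=
    (tendsto_finsetSum _ fun j _ => (h.tendsto_moment_div j).const_mul (T n j)).const_mul _
  have h2 : linForm a b c d H T n 1
      = (H n)⁻¹ * ∑ j ∈ Finset.range (n + 1), T n j * xi a b c d j 1 := by
    simp only [linForm, typeI₁, typeI₂, xi, mul_add, Finset.sum_add_distrib, Finset.mul_sum]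
    congr 1 <;> exact Finset.sum_congr rfl fun j _ => by ring
  rw [h2]
  refine tendsto_nhds_unique h1 ((h.tendsto_typeIIInv_div n).congr fun i => ?_)
  rw [← h.lowerInv_typeIICoeff, ← h.eq_typeIICoeff hG, ← hG.sum_mul_moment i n, mul_div_assoc,
    Finset.sum_div]
  simp only [mul_div_assoc]

/-! ### The left and right eigenvectors of the Jacobi matrix -/

theorem moment_succ (h : Admissible a b c d) (i j : ℕ) :
    moment a b c d (i + 1) j = moment a b c d i (j + 2) := by
  obtain ⟨k, rfl | rfl⟩ := Nat.even_or_odd' j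
  · rw [show 2 * k + 2 = 2 * (k + 1) by ring, h.moment_even, h.moment_even]
    congr 1; omega
  · rw [show 2 * k + 1 + 2 = 2 * (k + 1) + 1 by ring, h.moment_odd, h.moment_odd]
    congr 1; omega

/-- Divide row `i` of `S⁻¹ J = Λ S⁻¹` by the `i`-th moment of `w₁` and let `i → ∞`; the band
structure keeps the sum finite. -/
theorem sum_linFormOne_mul_jacobi (h : Admissible a b c d)
    (hG : IsGaussBorel (moment a b c d) S H T) (n : ℕ) :
    ∑ m ∈ Finset.range (n + 3), linFormOne a b c d m * jacobi S m n = linFormOne a b c d n := by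
  have hL : lowerInv S = typeIIInv a b c d := by
    rw [h.eq_typeIICoeff hG, h.lowerInv_typeIICoeff]
  have h1 : Tendsto (fun i => ∑ m ∈ Finset.range (n + 3),
      typeIIInv a b c d i m / pochRatio a b c d i * jacobi S m n) atTop
      (𝓝 (∑ m ∈ Finset.range (n + 3), linFormOne a b c d m * jacobi S m n)) :=
    tendsto_finsetSum _ fun m _ => (h.tendsto_typeIIInv_div m).mul_const _
  have h2 := (((h.tendsto_typeIIInv_div n).comp (tendsto_add_atTop_nat 1)).mul
    (h.tendsto_pochRatio_div 1))
  rw [mul_one] at h2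
  refine tendsto_nhds_unique h1 (h2.congr' ?_)
  filter_upwards [eventually_ge_atTop (n + 2)] with i hi
  have h3 : typeIIInv a b c d (i + 1) n
      = ∑ m ∈ Finset.range (n + 3), typeIIInv a b c d i m * jacobi S m n := by
    rw [← hL, hG.left.lowerInv_mul_jacobi]
    refine (Finset.sum_subset (Finset.range_mono (by omega)) fun m _ hm => ?_).symm
    rw [hG.jacobi_eq_zero h.moment_succ (by simp at hm; omega), mul_zero]
  have g1 := (h.pochRatio_pos i).ne'
  have g2 := (h.pochRatio_pos (i + 1)).ne'
  simp only [Function.comp_apply, h3]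
  rw [div_mul_div_cancel₀ g2, Finset.sum_div]
  exact Finset.sum_congr rfl fun m _ => by ring

theorem linFormOne_zero_eq (h : Admissible a b c d)
    (hG : IsGaussBorel (moment a b c d) S H T) :
    linFormOne a b c d 0 = linFormOne a b c d 0 * jacobi S 0 0 +
      linFormOne a b c d 1 * jacobi S 1 0 + linFormOne a b c d 2 * jacobi S 2 0 := by
  have h1 := h.sum_linFormOne_mul_jacobi hG 0
  simp only [Finset.sum_range_succ, Finset.sum_range_zero, zero_add] at h1
  linarith

theorem linFormOne_succ_eq (h : Admissible a b c d)
    (hG : IsGaussBorel (moment a b c d) S H T) (n : ℕ) :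
    linFormOne a b c d (n + 1) = linFormOne a b c d n +
      linFormOne a b c d (n + 1) * jacobi S (n + 1) (n + 1) +
      linFormOne a b c d (n + 2) * jacobi S (n + 2) (n + 1) +
      linFormOne a b c d (n + 3) * jacobi S (n + 3) (n + 1) := by
  have h1 := h.sum_linFormOne_mul_jacobi hG (n + 1)
  rw [Finset.sum_range_succ, Finset.sum_range_succ, Finset.sum_range_succ, Finset.sum_range_succ,
    Finset.sum_eq_zero, hG.left.jacobi_succ] at h1
  · linarith
  · intro m hm
    rw [jacobi_of_lt (by have := Finset.mem_range.1 hm; omega), mul_zero]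

theorem typeII_zero_eq (hG : IsGaussBorel (moment a b c d) S H T) :
    typeII S 0 1 = jacobi S 0 0 * typeII S 0 1 + typeII S 1 1 := by
  have h1 := hG.left.sum_jacobi_mul_typeII 0
  simp only [Finset.sum_range_succ, Finset.sum_range_zero, zero_add, hG.left.jacobi_succ 0] at h1
  linarith

theorem typeII_one_eq (hG : IsGaussBorel (moment a b c d) S H T) :
    typeII S 1 1 = jacobi S 1 0 * typeII S 0 1 + jacobi S 1 1 * typeII S 1 1 + typeII S 2 1 := by
  have h1 := hG.left.sum_jacobi_mul_typeII 1
  simp only [Finset.sum_range_succ, Finset.sum_range_zero, zero_add, hG.left.jacobi_succ 1] at h1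
  linarith

theorem typeII_add_two_eq (h : Admissible a b c d) (hG : IsGaussBorel (moment a b c d) S H T)
    (n : ℕ) :
    typeII S (n + 2) 1 = jacobi S (n + 2) n * typeII S n 1 +
      jacobi S (n + 2) (n + 1) * typeII S (n + 1) 1 +
      jacobi S (n + 2) (n + 2) * typeII S (n + 2) 1 + typeII S (n + 3) 1 := by
  have h1 := hG.left.sum_jacobi_mul_typeII (n + 2)
  rw [Finset.sum_range_succ, Finset.sum_range_succ, Finset.sum_range_succ, Finset.sum_range_succ,
    Finset.sum_eq_zero, hG.left.jacobi_succ] at h1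
  · linarith
  · intro m hm
    rw [hG.jacobi_eq_zero h.moment_succ (by have := Finset.mem_range.1 hm; omega), zero_mul]

/-- A recurrence of order two, with positive coefficients, for the values at `1` of the type II
polynomials. -/
theorem linFormOne_mul_typeII (h : Admissible a b c d)
    (hG : IsGaussBorel (moment a b c d) S H T) (n : ℕ) :
    linFormOne a b c d (n + 1) * typeII S (n + 2) 1 =
      (linFormOne a b c d (n + 1) * (1 - jacobi S (n + 1) (n + 1)) - linFormOne a b c d n) *
        typeII S (n + 1) 1 +
      linFormOne a b c d (n + 2) * jacobi S (n + 2) n * typeII S n 1 := by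
  -- Summing `q (J B - B) - (q J - q) B` up to a cut cancels everything except the entries of `J`
  -- straddling it; the left eigenvector equation then eliminates the first subdiagonal. The
  -- induction performs this telescoping.
  induction n with
  | zero =>
    have h1 := h.linFormOne_zero_eq hG
    have h2 := typeII_zero_eq hG
    have h3 := typeII_one_eq hG
    simp only [zero_add]
    linear_combination -linFormOne a b c d 0 * h2 - linFormOne a b c d 1 * h3 +
      typeII S 0 1 * h1
  | succ n ih =>
    have h1 := h.linFormOne_succ_eq hG n
    have h3 := h.typeII_add_two_eq hG n
    linear_combination ih - linFormOne a b c d (n + 2) * h3 + typeII S (n + 1) 1 * h1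

/-! ### Positivity -/

theorem typeIIInv_succ_self (h : Admissible a b c d) (n : ℕ) :
    typeIIInv a b c d (n + 1) n = (n + 1) * (a + n) * (b + n) /
      ((c + (n + (n + 1) / 2 : ℕ)) * (d + (n + n / 2 : ℕ))) := by
  have h1 := poch_ne_zero h.a_pos n
  have h2 := poch_ne_zero h.b_pos n
  have h3 := poch_ne_zero h.c_pos (n + (n + 1) / 2)
  have h4 := poch_ne_zero h.d_pos (n + n / 2)
  have h5 : (n.factorial : ℝ) ≠ 0 := by positivity
  have h6 : c + (n + (n + 1) / 2 : ℕ) ≠ 0 := by have := h.c_pos; positivity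
  have h7 : d + (n + n / 2 : ℕ) ≠ 0 := by have := h.d_pos; positivity
  have h8 : (n + 1).descFactorial n = (n + 1).factorial := by
    rw [← Nat.descFactorial_self (n + 1), Nat.descFactorial_succ]; simp
  rw [typeIIInv, linFormOne, shiftedRatio, h8, add_zero, add_right_comm, add_right_comm n 1,
    poch_succ, poch_succ, poch_succ, poch_succ, Nat.factorial_succ]
  push_cast at h6 h7 ⊢
  field_simp

theorem jacobi_zero_eq (h : Admissible a b c d) (hG : IsGaussBorel (moment a b c d) S H T) :
    jacobi S 0 0 = a * b / (c * d) := by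
  rw [hG.left.jacobi_zero, h.eq_typeIICoeff hG, h.lowerInv_typeIICoeff, ← zero_add 1,
    h.typeIIInv_succ_self]
  simp

theorem jacobi_succ_self (h : Admissible a b c d) (hG : IsGaussBorel (moment a b c d) S H T)
    (n : ℕ) : jacobi S (n + 1) (n + 1) =
      typeIIInv a b c d (n + 2) (n + 1) - typeIIInv a b c d (n + 1) n := by
  rw [hG.left.jacobi_diag_succ, h.eq_typeIICoeff hG, h.lowerInv_typeIICoeff]

theorem linFormOne_even_div (h : Admissible a b c d) (j : ℕ) :
    linFormOne a b c d (2 * j) / linFormOne a b c d (2 * j + 1) =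
      (2 * j + 1) * (a + 2 * j) * (b + 2 * j) /
        ((c + 3 * j) * (c + 3 * j + 1) * (d + 3 * j)) := by
  have hc := h.c_pos
  have hd := h.d_pos
  have h1 := poch_ne_zero h.a_pos (2 * j)
  have h2 := poch_ne_zero h.b_pos (2 * j)
  have h3 := poch_ne_zero hc (3 * j)
  have h4 := poch_ne_zero hd (3 * j)
  have h5 : ((2 * j).factorial : ℝ) ≠ 0 := by positivity
  have h6 : a + 2 * j ≠ 0 := by have := h.a_pos; positivity
  have h7 : b + 2 * j ≠ 0 := by have := h.b_pos; positivity
  have h8 : c + 3 * j ≠ 0 := by positivity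
  have h9 : c + (3 * j + 1) ≠ 0 := by positivity
  have h10 : d + 3 * j ≠ 0 := by positivity
  rw [linFormOne, linFormOne, show 2 * j + (2 * j + 1) / 2 = 3 * j by omega,
    show 2 * j + 2 * j / 2 = 3 * j by omega,
    show 2 * j + 1 + (2 * j + 1 + 1) / 2 = 3 * j + 1 + 1 by omega,
    show 2 * j + 1 + (2 * j + 1) / 2 = 3 * j + 1 by omega, poch_succ, poch_succ, poch_succ,
    poch_succ, poch_succ, Nat.factorial_succ]
  push_cast
  rw [add_assoc c]
  field_simp

theorem linFormOne_odd_div (h : Admissible a b c d) (j : ℕ) :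
    linFormOne a b c d (2 * j + 1) / linFormOne a b c d (2 * j + 2) =
      (2 * j + 2) * (a + 2 * j + 1) * (b + 2 * j + 1) /
        ((c + 3 * j + 2) * (d + 3 * j + 1) * (d + 3 * j + 2)) := by
  have hc := h.c_pos
  have hd := h.d_pos
  have h1 := poch_ne_zero h.a_pos (2 * j + 1)
  have h2 := poch_ne_zero h.b_pos (2 * j + 1)
  have h3 := poch_ne_zero hc (3 * j + 2)
  have h4 := poch_ne_zero hd (3 * j + 1)
  have h5 : ((2 * j + 1).factorial : ℝ) ≠ 0 := by positivity
  have h6 : a + (2 * j + 1) ≠ 0 := by have := h.a_pos; positivity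
  have h7 : b + (2 * j + 1) ≠ 0 := by have := h.b_pos; positivity
  have h8 : c + (3 * j + 2) ≠ 0 := by positivity
  have h9 : d + (3 * j + 1) ≠ 0 := by positivity
  have h10 : d + (3 * j + 2) ≠ 0 := by positivity
  rw [linFormOne, linFormOne, show 2 * j + 1 + (2 * j + 1 + 1) / 2 = 3 * j + 2 by omega,
    show 2 * j + 1 + (2 * j + 1) / 2 = 3 * j + 1 by omega,
    show 2 * j + 2 + (2 * j + 2 + 1) / 2 = 3 * j + 2 + 1 by omega,
    show 2 * j + 2 + (2 * j + 2) / 2 = 3 * j + 1 + 1 + 1 by omega,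
    show 2 * j + 2 = 2 * j + 1 + 1 by omega, poch_succ c (3 * j + 2), poch_succ d (3 * j + 1 + 1),
    poch_succ d (3 * j + 1), poch_succ a (2 * j + 1), poch_succ b (2 * j + 1),
    Nat.factorial_succ (2 * j + 1)]
  push_cast
  have e1 : d + (3 * (j : ℝ) + 1 + 1) = d + (3 * j + 2) := by ring
  have e2 : (2 * (j : ℝ) + 1 + 1) = 2 * j + 2 := by ring
  rw [e1, e2, add_assoc c, add_assoc d, add_assoc d, add_assoc a, add_assoc b]
  have h11 : 2 * (j : ℝ) + 2 ≠ 0 := by positivity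
  field_simp

end
end Admissible

namespace Admissible
variable {a b c d : ℝ}

/-- A parametrization of the admissible parameters. -/
theorem exists_parametrization (h : Admissible a b c d) :
    ∃ s t u v : ℝ, 0 < s ∧ 0 ≤ t ∧ 0 ≤ u ∧ 0 < v ∧
      ((a = s + t ∧ b = s ∧ c = s + t + u ∧ d = s + t + v) ∨
        (a = s ∧ b = s + t ∧ c = s + t + u ∧ d = s + t + v) ∨
        (a = s ∧ b = s + u + t ∧ c = s + u ∧ d = s + u + t + v)) := by
  obtain ⟨h1, h2, h3, h4, h5, -, -⟩ := h
  rcases le_total b a with hba | hab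
  · exact ⟨b, a - b, c - a, d - a, h2, by linarith, by linarith, by linarith, Or.inl
      ⟨by ring, rfl, by ring, by ring⟩⟩
  rcases le_total b c with hbc | hcb
  · exact ⟨a, b - a, c - b, d - b, h1, by linarith, by linarith, by linarith, Or.inr (Or.inl
      ⟨rfl, by ring, by ring, by ring⟩)⟩
  · exact ⟨a, b - c, c - a, d - b, h1, by linarith, by linarith, by linarith, Or.inr (Or.inr
      ⟨rfl, by ring, by ring, by ring⟩)⟩

/-- For each ordering of `a`, `b`, `c`, written in the smallest parameter and successive gaps, the
difference of the sides expands without negative coefficients. -/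
theorem even_poly_pos (h : Admissible a b c d) {k : ℝ} (hk : 0 ≤ k) :
    (2 * k + 3) * (a + 2 * k + 2) * (b + 2 * k + 2) * ((c + 3 * k + 2) * (d + 3 * k + 2)) <
      ((c + 3 * k + 2) * (d + 3 * k + 2) + (2 * k + 2) * (a + 2 * k + 1) * (b + 2 * k + 1)) *
        ((c + 3 * k + 3) * (d + 3 * k + 3)) := by
  obtain ⟨s, t, u, v, hs, ht, hu, hv, ⟨rfl, rfl, rfl, rfl⟩ | ⟨rfl, rfl, rfl, rfl⟩ |
    ⟨rfl, rfl, rfl, rfl⟩⟩ := h.exists_parametrization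
  all_goals
    rw [← sub_pos]
    ring_nf
    positivity

theorem odd_poly_pos (h : Admissible a b c d) {k : ℝ} (hk : 0 ≤ k) :
    (2 * k + 2) * (a + 2 * k + 1) * (b + 2 * k + 1) * ((c + 3 * k + 1) * (d + 3 * k)) <
      ((c + 3 * k + 1) * (d + 3 * k) + (2 * k + 1) * (a + 2 * k) * (b + 2 * k)) *
        ((c + 3 * k + 2) * (d + 3 * k + 1)) := by
  obtain ⟨s, t, u, v, hs, ht, hu, hv, ⟨rfl, rfl, rfl, rfl⟩ | ⟨rfl, rfl, rfl, rfl⟩ |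
    ⟨rfl, rfl, rfl, rfl⟩⟩ := h.exists_parametrization
  all_goals
    rw [← sub_pos]
    ring_nf
    positivity

theorem typeIIInv_even (h : Admissible a b c d) (j : ℕ) :
    typeIIInv a b c d (2 * j + 1) (2 * j) =
      (2 * j + 1) * (a + 2 * j) * (b + 2 * j) / ((c + 3 * j) * (d + 3 * j)) := by
  rw [h.typeIIInv_succ_self, show 2 * j + (2 * j + 1) / 2 = 3 * j by omega,
    show 2 * j + 2 * j / 2 = 3 * j by omega]
  push_cast; rfl

theorem typeIIInv_odd (h : Admissible a b c d) (j : ℕ) :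
    typeIIInv a b c d (2 * j + 2) (2 * j + 1) =
      (2 * j + 2) * (a + 2 * j + 1) * (b + 2 * j + 1) / ((c + 3 * j + 2) * (d + 3 * j + 1)) := by
  rw [h.typeIIInv_succ_self, show 2 * j + 1 + (2 * j + 1 + 1) / 2 = 3 * j + 2 by omega,
    show 2 * j + 1 + (2 * j + 1) / 2 = 3 * j + 1 by omega]
  push_cast; ring_nf

section
variable {S : ℕ → ℕ → ℝ} {H : ℕ → ℝ} {T : ℕ → ℕ → ℝ}

theorem one_sub_jacobi_zero_pos (h : Admissible a b c d)
    (hG : IsGaussBorel (moment a b c d) S H T) : 0 < 1 - jacobi S 0 0 := by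
  have hc := h.c_pos
  have hd := h.d_pos
  rw [h.jacobi_zero_eq hG, sub_pos, div_lt_one (by positivity)]
  have := h.a_le_c; have := h.b_lt_d; have := h.b_pos; have := h.a_pos
  nlinarith

/-- The quotient of linear forms merges with one of the two terms of the diagonal entry, as in
`x/(pr) - x/(p(p+1)r) = x/((p+1)r)`; what remains is one of the two polynomial inequalities. -/
theorem one_sub_jacobi_sub_pos (h : Admissible a b c d)
    (hG : IsGaussBorel (moment a b c d) S H T) (n : ℕ) :
    0 < 1 - jacobi S (n + 1) (n + 1) - linFormOne a b c d n / linFormOne a b c d (n + 1) := by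
  have hc := h.c_pos
  have hd := h.d_pos
  rw [h.jacobi_succ_self hG]
  obtain ⟨j, rfl | rfl⟩ := Nat.even_or_odd' n
  · rw [h.linFormOne_even_div, h.typeIIInv_even, h.typeIIInv_odd]
    have hp := h.odd_poly_pos (k := j) (by positivity)
    have e : 1 - ((2 * j + 2) * (a + 2 * j + 1) * (b + 2 * j + 1) /
          ((c + 3 * j + 2) * (d + 3 * j + 1)) -
        (2 * j + 1) * (a + 2 * j) * (b + 2 * j) / ((c + 3 * j) * (d + 3 * j))) -
        (2 * j + 1) * (a + 2 * j) * (b + 2 * j) / ((c + 3 * j) * (c + 3 * j + 1) * (d + 3 * j))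
        = (((c + 3 * j + 1) * (d + 3 * j) + (2 * j + 1) * (a + 2 * j) * (b + 2 * j)) *
          ((c + 3 * j + 2) * (d + 3 * j + 1)) -
          (2 * j + 2) * (a + 2 * j + 1) * (b + 2 * j + 1) * ((c + 3 * j + 1) * (d + 3 * j))) /
          (((c + 3 * j + 1) * (d + 3 * j)) * ((c + 3 * j + 2) * (d + 3 * j + 1))) := by
      have : c + 3 * j ≠ 0 := by positivity
      have : c + 3 * j + 1 ≠ 0 := by positivity
      have : c + 3 * j + 2 ≠ 0 := by positivity
      have : d + 3 * j ≠ 0 := by positivity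
      have : d + 3 * j + 1 ≠ 0 := by positivity
      field_simp
      ring
    rw [e]
    exact div_pos (sub_pos.2 hp) (by positivity)
  · rw [show 2 * j + 1 + 1 = 2 * j + 2 by ring, show 2 * j + 1 + 2 = 2 * (j + 1) + 1 by ring,
      show typeIIInv a b c d (2 * (j + 1) + 1) (2 * j + 2) =
        typeIIInv a b c d (2 * (j + 1) + 1) (2 * (j + 1)) by rw [mul_add, mul_one],
      h.linFormOne_odd_div, h.typeIIInv_even, h.typeIIInv_odd]
    have hp := h.even_poly_pos (k := j) (by positivity)
    have e : 1 - ((2 * (j + 1 : ℕ) + 1) * (a + 2 * (j + 1 : ℕ)) * (b + 2 * (j + 1 : ℕ)) /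
          ((c + 3 * (j + 1 : ℕ)) * (d + 3 * (j + 1 : ℕ))) -
        (2 * j + 2) * (a + 2 * j + 1) * (b + 2 * j + 1) / ((c + 3 * j + 2) * (d + 3 * j + 1))) -
        (2 * j + 2) * (a + 2 * j + 1) * (b + 2 * j + 1) /
          ((c + 3 * j + 2) * (d + 3 * j + 1) * (d + 3 * j + 2))
        = (((c + 3 * j + 2) * (d + 3 * j + 2) + (2 * j + 2) * (a + 2 * j + 1) * (b + 2 * j + 1)) *
          ((c + 3 * j + 3) * (d + 3 * j + 3)) -
          (2 * j + 3) * (a + 2 * j + 2) * (b + 2 * j + 2) * ((c + 3 * j + 2) * (d + 3 * j + 2))) /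
          (((c + 3 * j + 2) * (d + 3 * j + 2)) * ((c + 3 * j + 3) * (d + 3 * j + 3))) := by
      have e1 : c + 3 * (j + 1 : ℕ) = c + 3 * j + 3 := by push_cast; ring
      have e2 : d + 3 * (j + 1 : ℕ) = d + 3 * j + 3 := by push_cast; ring
      rw [e1, e2]
      have : c + 3 * j + 2 ≠ 0 := by positivity
      have : c + 3 * j + 3 ≠ 0 := by positivity
      have : d + 3 * j + 1 ≠ 0 := by positivity
      have : d + 3 * j + 2 ≠ 0 := by positivity
      have : d + 3 * j + 3 ≠ 0 := by positivity
      push_cast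
      field_simp
      ring
    rw [e]
    exact div_pos (sub_pos.2 hp) (by positivity)

/-! ### The second subdiagonal of the Jacobi matrix -/

theorem diag_eq (h : Admissible a b c d) (hG : IsGaussBorel (moment a b c d) S H T) (n : ℕ) :
    H n = lmul (typeIICoeff a b c d) (moment a b c d) n n := by
  rw [← h.eq_typeIICoeff hG, hG.lmul_diag]

/-- The product formula for `H` at even indices starts at 2, so the entry `(2, 0)` is not covered.
Nine linear factors over nine, written so as to match a product of limits of linear quotients. -/
theorem jacobi_even (h : Admissible a b c d) (hG : IsGaussBorel (moment a b c d) S H T) (j : ℕ) :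
    jacobi S (2 * j + 4) (2 * j + 2) =
      ((a + 2 + 2 * j) * (a + 3 + 2 * j) * ((b + 2 + 2 * j) * (b + 3 + 2 * j)) *
        ((3 + 2 * j) * (4 + 2 * j)) * ((d - a + 1 + 1 * j) * (d - b + 1 + 1 * j) * (d + 1 * j))) /
      ((c + 3 + 3 * j) * (c + 4 + 3 * j) * ((c + 5 + 3 * j) * (d + 2 + 3 * j)) *
        ((d + 3 + 3 * j) * (d + 4 + 3 * j)) *
        ((d + 3 + 3 * j) * (d + 4 + 3 * j) * (d + 5 + 3 * j))) := by
  have hc := h.c_pos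
  have hd := h.d_pos
  have h1 := poch_ne_zero h.a_pos (2 * j + 2)
  have h2 := poch_ne_zero h.b_pos (2 * j + 2)
  have h3 := poch_ne_zero (sub_pos.2 h.a_lt_d) (j + 1)
  have h4 := poch_ne_zero (sub_pos.2 h.b_lt_d) (j + 1)
  have h5 := poch_ne_zero hc (3 * j + 3)
  have h6 := poch_ne_zero hd (3 * j + 2)
  have h7 := poch_ne_zero (show 0 < d + j + 1 by positivity) (2 * j + 2)
  have h8 : ((2 * j + 2).factorial : ℝ) ≠ 0 := by positivity
  rw [show 2 * j + 4 = 2 * j + 2 + 2 by ring, hG.jacobi_add_two h.moment_succ, h.diag_eq hG,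
    h.diag_eq hG, show 2 * j + 2 + 2 = 2 * (j + 1) + 2 by ring, h.lmul_moment_even,
    h.lmul_moment_even]
  have ea : poch a (2 * (j + 1) + 2)
      = poch a (2 * j + 2) * ((a + 2 + 2 * j) * (a + 3 + 2 * j)) := by
    rw [show 2 * (j + 1) + 2 = 2 * j + 2 + 1 + 1 by ring, poch_succ, poch_succ]; push_cast; ring
  have eb : poch b (2 * (j + 1) + 2)
      = poch b (2 * j + 2) * ((b + 2 + 2 * j) * (b + 3 + 2 * j)) := by
    rw [show 2 * (j + 1) + 2 = 2 * j + 2 + 1 + 1 by ring, poch_succ, poch_succ]; push_cast; ring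
  have ef : ((2 * (j + 1) + 2).factorial : ℝ)
      = (2 * j + 2).factorial * ((3 + 2 * j) * (4 + 2 * j)) := by
    rw [show 2 * (j + 1) + 2 = 2 * j + 2 + 1 + 1 by ring, Nat.factorial_succ (2 * j + 2 + 1),
      Nat.factorial_succ (2 * j + 2)]
    push_cast; ring
  have ed1 : poch (d - a) (j + 1 + 1) = poch (d - a) (j + 1) * (d - a + 1 + 1 * j) := by
    rw [poch_succ]; push_cast; ring
  have ed2 : poch (d - b) (j + 1 + 1) = poch (d - b) (j + 1) * (d - b + 1 + 1 * j) := by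
    rw [poch_succ]; push_cast; ring
  have ec : poch c (3 * (j + 1) + 3)
      = poch c (3 * j + 3) * ((c + 3 + 3 * j) * (c + 4 + 3 * j) * (c + 5 + 3 * j)) := by
    rw [show 3 * (j + 1) + 3 = 3 * j + 3 + 1 + 1 + 1 by ring, poch_succ, poch_succ, poch_succ]
    push_cast; ring
  have ed : poch d (3 * (j + 1) + 2)
      = poch d (3 * j + 2) * ((d + 2 + 3 * j) * (d + 3 + 3 * j) * (d + 4 + 3 * j)) := by
    rw [show 3 * (j + 1) + 2 = 3 * j + 2 + 1 + 1 + 1 by ring, poch_succ, poch_succ, poch_succ]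
    push_cast; ring
  have en : poch (d + (j + 1 : ℕ)) (2 * (j + 1) + 3) = poch (d + j + 1) (2 * j + 2) *
      ((d + 3 + 3 * j) * (d + 4 + 3 * j) * (d + 5 + 3 * j)) := by
    rw [show 2 * (j + 1) + 3 = 2 * j + 2 + 1 + 1 + 1 by ring, poch_succ, poch_succ, poch_succ]
    push_cast; ring_nf
  have em : poch (d + j) (2 * j + 3) = (d + 1 * j) * poch (d + j + 1) (2 * j + 2) := by
    rw [poch_succ', one_mul]
  rw [ea, eb, ef, ed1, ed2, ec, ed, en, em]
  have g0 : d + 1 * j ≠ 0 := by positivity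
  have g1 : c + 3 + 3 * j ≠ 0 := by positivity
  have g2 : c + 4 + 3 * j ≠ 0 := by positivity
  have g3 : c + 5 + 3 * j ≠ 0 := by positivity
  have g4 : d + 2 + 3 * j ≠ 0 := by positivity
  have g5 : d + 3 + 3 * j ≠ 0 := by positivity
  have g6 : d + 4 + 3 * j ≠ 0 := by positivity
  have g7 : d + 5 + 3 * j ≠ 0 := by positivity
  field_simp

/-- The possibly negative factor `c - b` occurs in both `H (n+2)` and `H n` and cancels; every
remaining factor is positive. -/
theorem jacobi_odd (h : Admissible a b c d) (hG : IsGaussBorel (moment a b c d) S H T) (j : ℕ) :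
    jacobi S (2 * j + 3) (2 * j + 1) =
      ((a + 1 + 2 * j) * (a + 2 + 2 * j) * ((b + 1 + 2 * j) * (b + 2 + 2 * j)) *
        ((2 + 2 * j) * (3 + 2 * j)) * ((c - a + 1 + 1 * j) * (c - b + 1 + 1 * j) * (c + 1 * j))) /
      ((c + 1 + 3 * j) * (c + 2 + 3 * j) * ((c + 3 + 3 * j) * (d + 1 + 3 * j)) *
        ((d + 2 + 3 * j) * (d + 3 + 3 * j)) *
        ((c + 2 + 3 * j) * (c + 3 + 3 * j) * (c + 4 + 3 * j))) := by
  have hb := h.b_pos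
  have hc := h.c_pos
  have hd := h.d_pos
  have h1 := poch_ne_zero h.a_pos (2 * j + 1)
  have h2 := poch_ne_zero h.b_pos (2 * j + 1)
  have h3 := poch_ne_zero (show 0 < c - a + 1 by linarith [h.a_le_c]) j
  have h4 := h.poch_sub_ne_zero (j + 1)
  have h5 := poch_ne_zero hc (3 * j + 1)
  have h6 := poch_ne_zero hd (3 * j + 1)
  have h7 := poch_ne_zero (show 0 < c + j + 1 by positivity) (2 * j + 1)
  have h8 : ((2 * j + 1).factorial : ℝ) ≠ 0 := by positivity
  rw [show 2 * j + 3 = 2 * j + 1 + 2 by ring, hG.jacobi_add_two h.moment_succ, h.diag_eq hG,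
    h.diag_eq hG, show 2 * j + 1 + 2 = 2 * (j + 1) + 1 by ring, h.lmul_moment_odd,
    h.lmul_moment_odd]
  have ea : poch a (2 * (j + 1) + 1)
      = poch a (2 * j + 1) * ((a + 1 + 2 * j) * (a + 2 + 2 * j)) := by
    rw [show 2 * (j + 1) + 1 = 2 * j + 1 + 1 + 1 by ring, poch_succ, poch_succ]; push_cast; ring
  have eb : poch b (2 * (j + 1) + 1)
      = poch b (2 * j + 1) * ((b + 1 + 2 * j) * (b + 2 + 2 * j)) := by
    rw [show 2 * (j + 1) + 1 = 2 * j + 1 + 1 + 1 by ring, poch_succ, poch_succ]; push_cast; ring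
  have ef : ((2 * (j + 1) + 1).factorial : ℝ)
      = (2 * j + 1).factorial * ((2 + 2 * j) * (3 + 2 * j)) := by
    rw [show 2 * (j + 1) + 1 = 2 * j + 1 + 1 + 1 by ring, Nat.factorial_succ (2 * j + 1 + 1),
      Nat.factorial_succ (2 * j + 1)]
    push_cast; ring
  have ed1 : poch (c - a + 1) (j + 1) = poch (c - a + 1) j * (c - a + 1 + 1 * j) := by
    rw [poch_succ, one_mul]
  have ed2 : poch (c - b) (j + 1 + 1) = poch (c - b) (j + 1) * (c - b + 1 + 1 * j) := by
    rw [poch_succ]; push_cast; ring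
  have ec : poch c (3 * (j + 1) + 1)
      = poch c (3 * j + 1) * ((c + 1 + 3 * j) * (c + 2 + 3 * j) * (c + 3 + 3 * j)) := by
    rw [show 3 * (j + 1) + 1 = 3 * j + 1 + 1 + 1 + 1 by ring, poch_succ, poch_succ, poch_succ]
    push_cast; ring
  have ed : poch d (3 * (j + 1) + 1)
      = poch d (3 * j + 1) * ((d + 1 + 3 * j) * (d + 2 + 3 * j) * (d + 3 + 3 * j)) := by
    rw [show 3 * (j + 1) + 1 = 3 * j + 1 + 1 + 1 + 1 by ring, poch_succ, poch_succ, poch_succ]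
    push_cast; ring
  have en : poch (c + (j + 1 : ℕ)) (2 * (j + 1) + 2) = poch (c + j + 1) (2 * j + 1) *
      ((c + 2 + 3 * j) * (c + 3 + 3 * j) * (c + 4 + 3 * j)) := by
    rw [show 2 * (j + 1) + 2 = 2 * j + 1 + 1 + 1 + 1 by ring, poch_succ, poch_succ, poch_succ]
    push_cast; ring_nf
  have em : poch (c + j) (2 * j + 2) = (c + 1 * j) * poch (c + j + 1) (2 * j + 1) := by
    rw [poch_succ', one_mul]
  rw [ea, eb, ef, ed1, ed2, ec, ed, en, em]
  have g0 : c + 1 * j ≠ 0 := by positivity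
  have g1 : c + 1 + 3 * j ≠ 0 := by positivity
  have g2 : c + 2 + 3 * j ≠ 0 := by positivity
  have g3 : c + 3 + 3 * j ≠ 0 := by positivity
  have g4 : c + 4 + 3 * j ≠ 0 := by positivity
  have g5 : d + 1 + 3 * j ≠ 0 := by positivity
  have g6 : d + 2 + 3 * j ≠ 0 := by positivity
  have g7 : d + 3 + 3 * j ≠ 0 := by positivity
  have g8 := h.b_pos.ne'
  field_simp

theorem jacobi_add_two_pos (h : Admissible a b c d) (hG : IsGaussBorel (moment a b c d) S H T)
    (n : ℕ) : 0 < jacobi S (n + 2) n := by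
  have ha := h.a_pos
  have hb := h.b_pos
  have hc := h.c_pos
  have hd := h.d_pos
  have hda := sub_pos.2 h.a_lt_d
  have hdb := sub_pos.2 h.b_lt_d
  obtain ⟨j, rfl | rfl⟩ := Nat.even_or_odd' n
  · rcases j with _ | j
    · rw [mul_zero, hG.jacobi_add_two h.moment_succ, h.diag_eq hG, h.diag_eq hG,
        h.lmul_moment_zero, show 0 + 2 = 2 * 0 + 2 by rfl, h.lmul_moment_even 0]
      have h1 := poch_pos h.a_pos 2
      have h2 := poch_pos h.b_pos 2
      have h3 := poch_pos (sub_pos.2 h.a_lt_d) 1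
      have h4 := poch_pos (sub_pos.2 h.b_lt_d) 1
      have h5 := poch_pos hc 3
      have h6 := poch_pos hd 2
      have h7 := poch_pos (show 0 < d + (0 : ℕ) by simpa) 3
      simp only [mul_zero, zero_add]
      positivity
    · rw [show 2 * (j + 1) = 2 * j + 2 by ring, h.jacobi_even hG]
      positivity
  · rw [h.jacobi_odd hG]
    have h1 : 0 < c - a + 1 := by linarith [h.a_le_c]
    have h2 : 0 < c - b + 1 := by linarith [h.b_lt_c]
    positivity

theorem typeII_one_pos (h : Admissible a b c d) (hG : IsGaussBorel (moment a b c d) S H T)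
    (n : ℕ) : 0 < typeII S n 1 := by
  have h0 : typeII S 0 1 = 1 := by simp [typeII, hG.left.diag]
  suffices ∀ n, 0 < typeII S n 1 ∧ 0 < typeII S (n + 1) 1 from (this n).1
  intro n
  induction n with
  | zero =>
    have h1 := typeII_zero_eq hG
    have h2 := h.one_sub_jacobi_zero_pos hG
    rw [h0] at h1 ⊢
    exact ⟨one_pos, by rw [zero_add]; linarith⟩
  | succ n ih =>
    refine ⟨ih.2, ?_⟩
    have h1 := h.linFormOne_mul_typeII hG n
    have q1 := h.linFormOne_pos (n + 1)
    have q2 := h.linFormOne_pos (n + 2)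
    have h2 := mul_pos q1 (h.one_sub_jacobi_sub_pos hG n)
    have h3 : linFormOne a b c d (n + 1) * (1 - jacobi S (n + 1) (n + 1) -
        linFormOne a b c d n / linFormOne a b c d (n + 1)) =
        linFormOne a b c d (n + 1) * (1 - jacobi S (n + 1) (n + 1)) - linFormOne a b c d n := by
      field_simp
    rw [h3] at h2
    have h4 := mul_pos (mul_pos q2 (h.jacobi_add_two_pos hG n)) ih.1
    have h5 := mul_pos h2 ih.2
    exact pos_of_mul_pos_right (h1 ▸ add_pos h5 h4) q1.le

end
end Admissible

/-! ### Limits -/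

theorem tendsto_of_even_of_odd {f : ℕ → ℝ} {l : ℝ}
    (h0 : Tendsto (fun j => f (2 * j)) atTop (𝓝 l))
    (h1 : Tendsto (fun j => f (2 * j + 1)) atTop (𝓝 l)) : Tendsto f atTop (𝓝 l) := by
  rw [Metric.tendsto_atTop] at h0 h1 ⊢
  intro ε hε
  obtain ⟨N0, hN0⟩ := h0 ε hε
  obtain ⟨N1, hN1⟩ := h1 ε hε
  refine ⟨2 * (N0 + N1) + 1, fun n hn => ?_⟩
  obtain ⟨j, rfl | rfl⟩ := Nat.even_or_odd' n
  · exact hN0 j (by omega)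
  · exact hN1 j (by omega)

/-- Diagonal entries of `J` are differences of two such quotients, both growing like `8j/9`, so the
constant term of the expansion is needed. It is read off at `t = 1/j = 0`. -/
theorem tendsto_cubic_div_quadratic (x y z v w : ℝ) :
    Tendsto (fun j : ℕ => (x + 2 * j) * (y + 2 * j) * (z + 2 * j) / ((v + 3 * j) * (w + 3 * j))
      - 8 / 9 * j) atTop (𝓝 (4 / 9 * (x + y + z) - 8 / 27 * (v + w))) := by
  have ht : Tendsto (fun i : ℕ => (i : ℝ)⁻¹) atTop (𝓝 0) := tendsto_inv_atTop_nhds_zero_nat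
  have hcont : ContinuousAt (fun t : ℝ =>
      (4 * (x + y + z) - 8 / 3 * (v + w) + (2 * (x * y + y * z + z * x) - 8 / 9 * (v * w)) * t
        + x * y * z * t ^ 2) / ((v * t + 3) * (w * t + 3))) 0 := by
    refine ContinuousAt.div (by fun_prop) (by fun_prop) (by norm_num)
  have h := hcont.tendsto.comp ht
  have e : (4 * (x + y + z) - 8 / 3 * (v + w) + (2 * (x * y + y * z + z * x) - 8 / 9 * (v * w)) * 0
      + x * y * z * 0 ^ 2) / ((v * 0 + 3) * (w * 0 + 3))
      = 4 / 9 * (x + y + z) - 8 / 27 * (v + w) := by ring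
  rw [e] at h
  have hv : ∀ u : ℝ, ∀ᶠ j : ℕ in atTop, 0 < u + 3 * (j : ℝ) := fun u =>
    (tendsto_atTop_add_const_left _ u
      (tendsto_natCast_atTop_atTop.const_mul_atTop (by norm_num : (0 : ℝ) < 3))).eventually_gt_atTop 0
  refine h.congr' ?_
  filter_upwards [eventually_gt_atTop 0, hv v, hv w] with j hj h1 h2
  have hj' : (j : ℝ) ≠ 0 := by exact_mod_cast hj.ne'
  have e1 : v * (j : ℝ)⁻¹ + 3 = (v + 3 * j) / j := by field_simp
  have e2 : w * (j : ℝ)⁻¹ + 3 = (w + 3 * j) / j := by field_simp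
  simp only [Function.comp_apply]
  rw [e1, e2]
  have h1' := h1.ne'
  have h2' := h2.ne'
  field_simp
  ring

/-- The limit map `r ↦ 7/27 + (8/729)/r` fixes `8/27`. Once `r > 6/27`, each step contracts the
distance to `8/27` by at least `1/2`, up to an error tending to 0. -/
theorem tendsto_of_affine_recurrence {r u v : ℕ → ℝ} (hr : ∀ n, 0 < r n)
    (h : ∀ n, r (n + 1) = u n + v n / r n) (hv0 : ∀ n, 0 < v n)
    (hu : Tendsto u atTop (𝓝 (7 / 27))) (hv : Tendsto v atTop (𝓝 (8 / 729))) :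
    Tendsto r atTop (𝓝 (8 / 27)) := by
  have herr : Tendsto (fun n => |u n - 7 / 27| + |v n - 8 / 729| * (27 / 8)) atTop (𝓝 0) := by
    have h1 := (hu.sub_const (7 / 27)).abs.add ((hv.sub_const (8 / 729)).abs.mul_const (27 / 8))
    simpa using h1
  have hev : ∀ᶠ n in atTop, 6 / 27 < u n ∧ v n < 10 / 729 :=
    (hu.eventually (lt_mem_nhds (by norm_num))).and (hv.eventually (gt_mem_nhds (by norm_num)))
  obtain ⟨N, hN⟩ := eventually_atTop.1 hev
  have hstep : ∀ n, N + 1 ≤ n → |r (n + 1) - 8 / 27| ≤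
      (|u n - 7 / 27| + |v n - 8 / 729| * (27 / 8)) + 1 / 2 * |r n - 8 / 27| := by
    intro n hn
    obtain ⟨m, rfl⟩ : ∃ m, n = m + 1 := ⟨n - 1, by omega⟩
    -- The lower bound comes from the recurrence itself, which is why the estimate starts at `N + 1`
    -- and not at `N`.
    have hlow : 6 / 27 < r (m + 1) := by
      rw [h m]
      have := (hN m (by omega)).1
      have := div_pos (hv0 m) (hr m)
      linarith
    have hv1 := (hN (m + 1) (by omega)).2
    have hr1 := hr (m + 1)
    have e : r (m + 1 + 1) - 8 / 27 = (u (m + 1) - 7 / 27) + (v (m + 1) - 8 / 729) * (27 / 8)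
        - v (m + 1) * (27 / 8) / r (m + 1) * (r (m + 1) - 8 / 27) := by
      rw [h (m + 1)]
      field_simp
      ring
    have hcoef : |v (m + 1) * (27 / 8) / r (m + 1)| ≤ 1 / 2 := by
      have := hv0 (m + 1)
      rw [abs_of_pos (by positivity), div_le_iff₀ hr1]
      linarith
    rw [e]
    refine (abs_sub _ _).trans (add_le_add ((abs_add_le _ _).trans (add_le_add le_rfl ?_)) ?_)
    · rw [abs_mul, abs_of_pos (show (0 : ℝ) < 27 / 8 by norm_num)]
    · rw [abs_mul]
      exact mul_le_mul_of_nonneg_right hcoef (abs_nonneg _)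
  rw [Metric.tendsto_atTop]
  intro ε hε
  obtain ⟨K, hK⟩ := eventually_atTop.1 (herr.eventually (gt_mem_nhds (show 0 < ε / 4 by linarith)))
  set L := max (N + 1) K with hL
  have hbound : ∀ n, |r (L + n) - 8 / 27| ≤ (1 / 2) ^ n * |r L - 8 / 27| + ε / 2 := by
    intro n
    induction n with
    | zero => simp; linarith
    | succ n ih =>
      have h1 := hstep (L + n) (le_trans (le_max_left _ _) (Nat.le_add_right _ _))
      have h2 := hK (L + n) (le_trans (le_max_right _ _) (Nat.le_add_right _ _))
      rw [← add_assoc, pow_succ]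
      linarith
  have hpow : Tendsto (fun n : ℕ => (1 / 2 : ℝ) ^ n * |r L - 8 / 27|) atTop (𝓝 0) := by
    simpa using (tendsto_pow_atTop_nhds_zero_of_lt_one (r := (1 / 2 : ℝ)) (by norm_num)
      (by norm_num)).mul_const |r L - 8 / 27|
  obtain ⟨M, hM⟩ := eventually_atTop.1 (hpow.eventually (gt_mem_nhds (show 0 < ε / 2 by linarith)))
  refine ⟨L + M, fun n hn => ?_⟩
  obtain ⟨k, rfl⟩ := Nat.exists_eq_add_of_le (show L ≤ n by omega)
  rw [Real.dist_eq]
  have := hbound k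
  have := hM k (by omega)
  linarith

/-! ### Limits of the eigenvector ratios and of the diagonals of the Jacobi matrix -/

namespace Admissible
variable {a b c d : ℝ}

theorem tendsto_linFormOne_div (h : Admissible a b c d) :
    Tendsto (fun n => linFormOne a b c d n / linFormOne a b c d (n + 1)) atTop (𝓝 (8 / 27)) := by
  have t3 : (3 : ℝ) ≠ 0 := by norm_num
  refine tendsto_of_even_of_odd ?_ ?_
  · have h1 := ((tendsto_linear_div_linear 1 c 2 t3).mul
      (tendsto_linear_div_linear a (c + 1) 2 t3)).mul (tendsto_linear_div_linear b d 2 t3)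
    norm_num at h1
    refine h1.congr fun j => ?_
    rw [h.linFormOne_even_div, div_mul_div_comm, div_mul_div_comm]
    congr 1 <;> ring
  · have h1 := ((tendsto_linear_div_linear 2 (c + 2) 2 t3).mul
      (tendsto_linear_div_linear (a + 1) (d + 1) 2 t3)).mul
      (tendsto_linear_div_linear (b + 1) (d + 2) 2 t3)
    norm_num at h1
    refine h1.congr fun j => ?_
    rw [h.linFormOne_odd_div, div_mul_div_comm, div_mul_div_comm]
    congr 1 <;> ring

theorem tendsto_linFormOne_succ_div (h : Admissible a b c d) :
    Tendsto (fun n => linFormOne a b c d (n + 1) / linFormOne a b c d n) atTop (𝓝 (27 / 8)) := by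
  have := h.tendsto_linFormOne_div.inv₀ (by norm_num)
  simpa using this

section
variable {S : ℕ → ℕ → ℝ} {H : ℕ → ℝ} {T : ℕ → ℕ → ℝ}

theorem tendsto_jacobi_add_two (h : Admissible a b c d)
    (hG : IsGaussBorel (moment a b c d) S H T) :
    Tendsto (fun n => jacobi S (n + 2) n) atTop (𝓝 (64 / 19683)) := by
  have t3 : (3 : ℝ) ≠ 0 := by norm_num
  refine tendsto_of_even_of_odd ?_ ?_
  · rw [← tendsto_add_atTop_iff_nat 1]
    have h1 := (((((tendsto_linear_div_linear (a + 2) (c + 3) 2 t3).mul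
      (tendsto_linear_div_linear (a + 3) (c + 4) 2 t3))).mul
      ((tendsto_linear_div_linear (b + 2) (c + 5) 2 t3).mul
      (tendsto_linear_div_linear (b + 3) (d + 2) 2 t3))).mul
      ((tendsto_linear_div_linear 3 (d + 3) 2 t3).mul
      (tendsto_linear_div_linear 4 (d + 4) 2 t3))).mul
      (((tendsto_linear_div_linear (d - a + 1) (d + 3) 1 t3).mul
      (tendsto_linear_div_linear (d - b + 1) (d + 4) 1 t3)).mul
      (tendsto_linear_div_linear d (d + 5) 1 t3))
    simp only [div_mul_div_comm] at h1
    norm_num only at h1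
    refine h1.congr fun j => ?_
    rw [show 2 * (j + 1) + 2 = 2 * j + 4 by ring, show 2 * (j + 1) = 2 * j + 2 by ring,
      h.jacobi_even hG]
  · have h1 := (((((tendsto_linear_div_linear (a + 1) (c + 1) 2 t3).mul
      (tendsto_linear_div_linear (a + 2) (c + 2) 2 t3))).mul
      ((tendsto_linear_div_linear (b + 1) (c + 3) 2 t3).mul
      (tendsto_linear_div_linear (b + 2) (d + 1) 2 t3))).mul
      ((tendsto_linear_div_linear 2 (d + 2) 2 t3).mul
      (tendsto_linear_div_linear 3 (d + 3) 2 t3))).mul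
      (((tendsto_linear_div_linear (c - a + 1) (c + 2) 1 t3).mul
      (tendsto_linear_div_linear (c - b + 1) (c + 3) 1 t3)).mul
      (tendsto_linear_div_linear c (c + 4) 1 t3))
    simp only [div_mul_div_comm] at h1
    norm_num only at h1
    refine h1.congr fun j => ?_
    rw [show 2 * j + 1 + 2 = 2 * j + 3 by ring, h.jacobi_odd hG]

theorem tendsto_jacobi_diag (h : Admissible a b c d)
    (hG : IsGaussBorel (moment a b c d) S H T) :
    Tendsto (fun n => jacobi S n n) atTop (𝓝 (4 / 9)) := by
  rw [← tendsto_add_atTop_iff_nat 1]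
  have hodd := tendsto_cubic_div_quadratic 2 (a + 1) (b + 1) (c + 2) (d + 1)
  refine tendsto_of_even_of_odd ?_ ?_
  · have h1 := hodd.sub (tendsto_cubic_div_quadratic 1 a b c d)
    rw [show 4 / 9 * (2 + (a + 1) + (b + 1)) - 8 / 27 * (c + 2 + (d + 1)) -
      (4 / 9 * (1 + a + b) - 8 / 27 * (c + d)) = 4 / 9 by ring] at h1
    refine h1.congr fun j => ?_
    rw [h.jacobi_succ_self hG, h.typeIIInv_odd, h.typeIIInv_even, sub_sub_sub_cancel_right]
    congr 2 <;> ring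
  · have h1 := (tendsto_cubic_div_quadratic 3 (a + 2) (b + 2) (c + 3) (d + 3)).sub hodd
    rw [show 4 / 9 * (3 + (a + 2) + (b + 2)) - 8 / 27 * (c + 3 + (d + 3)) -
      (4 / 9 * (2 + (a + 1) + (b + 1)) - 8 / 27 * (c + 2 + (d + 1))) = 4 / 9 by ring] at h1
    refine h1.congr fun j => ?_
    have e : typeIIInv a b c d (2 * j + 1 + 2) (2 * j + 1 + 1) =
        typeIIInv a b c d (2 * (j + 1) + 1) (2 * (j + 1)) := by
      congr 1
    rw [h.jacobi_succ_self hG, e, h.typeIIInv_even, show 2 * j + 1 + 1 = 2 * j + 2 by ring,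
      h.typeIIInv_odd, sub_sub_sub_cancel_right]
    push_cast
    congr 2 <;> ring

theorem tendsto_linFormOne_two_div (h : Admissible a b c d) :
    Tendsto (fun n => linFormOne a b c d (n + 2) / linFormOne a b c d n) atTop
      (𝓝 (27 / 8 * (27 / 8))) := by
  refine ((h.tendsto_linFormOne_succ_div.comp (tendsto_add_atTop_nat 1)).mul
    h.tendsto_linFormOne_succ_div).congr fun n => ?_
  exact div_mul_div_cancel₀ (h.linFormOne_pos (n + 1)).ne'

/-- No closed form is needed: the left eigenvector equation expresses this subdiagonal through
quantities with known limits. -/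
theorem tendsto_jacobi_sub (h : Admissible a b c d)
    (hG : IsGaussBorel (moment a b c d) S H T) :
    Tendsto (fun n => jacobi S (n + 1) n) atTop (𝓝 (16 / 243)) := by
  rw [← tendsto_add_atTop_iff_nat 1]
  have q0 := h.tendsto_linFormOne_div
  have q1 := h.tendsto_linFormOne_succ_div.comp (tendsto_add_atTop_nat 2)
  have hb := (h.tendsto_jacobi_diag hG).comp (tendsto_add_atTop_nat 1)
  have hg := (h.tendsto_jacobi_add_two hG).comp (tendsto_add_atTop_nat 1)
  have h1 := (((hb.const_sub 1).sub q0).mul (q0.comp (tendsto_add_atTop_nat 1))).sub (q1.mul hg)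
  norm_num only at h1
  refine h1.congr fun n => ?_
  have p1 := (h.linFormOne_pos (n + 1)).ne'
  have p2 := (h.linFormOne_pos (n + 2)).ne'
  have e := h.linFormOne_succ_eq hG n
  simp only [Function.comp_apply]
  rw [show n + 1 + 1 = n + 2 by ring, show n + 2 + 1 = n + 3 by ring,
    show n + 1 + 2 = n + 3 by ring]
  field_simp
  linear_combination e

/-- Dividing the second-order recurrence by `q (n+1) * B (n+1)` gives a Riccati recurrence for `B
(n+1) / B n`, with `7/27 = 1 - 4/9 - 8/27` and `8/729 = (27/8)(4/27)³`. -/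
theorem tendsto_typeII_div (h : Admissible a b c d)
    (hG : IsGaussBorel (moment a b c d) S H T) :
    Tendsto (fun n => typeII S (n + 1) 1 / typeII S n 1) atTop (𝓝 (8 / 27)) := by
  have hB := h.typeII_one_pos hG
  have hq := h.linFormOne_pos
  refine tendsto_of_affine_recurrence
    (u := fun n => 1 - jacobi S (n + 1) (n + 1) - linFormOne a b c d n / linFormOne a b c d (n + 1))
    (v := fun n => linFormOne a b c d (n + 2) / linFormOne a b c d (n + 1) * jacobi S (n + 2) n)
    (fun n => div_pos (hB _) (hB _)) (fun n => ?_)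
    (fun n => mul_pos (div_pos (hq _) (hq _)) (h.jacobi_add_two_pos hG n)) ?_ ?_
  · have e := h.linFormOne_mul_typeII hG n
    have p0 := (hB n).ne'
    have p1 := (hB (n + 1)).ne'
    have p2 := (hq (n + 1)).ne'
    rw [show n + 1 + 1 = n + 2 by ring]
    field_simp
    linear_combination e
  · have h1 := (((h.tendsto_jacobi_diag hG).comp (tendsto_add_atTop_nat 1)).const_sub 1).sub
      h.tendsto_linFormOne_div
    norm_num only at h1
    exact h1
  · have h1 := (h.tendsto_linFormOne_succ_div.comp (tendsto_add_atTop_nat 1)).mul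
      (h.tendsto_jacobi_add_two hG)
    norm_num only at h1
    exact h1

theorem tendsto_typeII_div_succ (h : Admissible a b c d)
    (hG : IsGaussBorel (moment a b c d) S H T) :
    Tendsto (fun n => typeII S n 1 / typeII S (n + 1) 1) atTop (𝓝 (27 / 8)) := by
  have := (h.tendsto_typeII_div hG).inv₀ (by norm_num)
  simpa using this

theorem tendsto_typeII_div_two (h : Admissible a b c d)
    (hG : IsGaussBorel (moment a b c d) S H T) :
    Tendsto (fun n => typeII S n 1 / typeII S (n + 2) 1) atTop (𝓝 (27 / 8 * (27 / 8))) := by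
  refine ((h.tendsto_typeII_div_succ hG).mul
    ((h.tendsto_typeII_div_succ hG).comp (tendsto_add_atTop_nat 1))).congr fun n => ?_
  exact div_mul_div_cancel₀ (h.typeII_one_pos hG (n + 1)).ne'

theorem exists_tendsto_PI_PII (h : Admissible a b c d)
    (hG : IsGaussBorel (moment a b c d) S H T) {k : ℤ} (hk : k ∈ ({-2, -1, 0, 1, 2} : Set ℤ)) :
    ∃ L : ℝ, Tendsto (fun n : ℕ => PI a b c d S H T n ((n : ℤ) + k).toNat) atTop (𝓝 L) ∧
      Tendsto (fun n : ℕ => PII S ((n : ℤ) + k).toNat n) atTop (𝓝 L) := by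
  simp only [PI, PII, h.linForm_one hG]
  rcases hk with rfl | rfl | rfl | rfl | rfl
  · refine ⟨0, ?_, ?_⟩ <;>
    · refine tendsto_const_nhds.congr' ?_
      -- For `n ≥ 2` the index `n - 2` is not truncated by `toNat`, and the entry lies above the
      -- superdiagonal.
      filter_upwards [eventually_ge_atTop 2] with n hn
      rw [jacobi_of_lt (by omega), mul_zero]
  · have e : ∀ n : ℕ, ((n + 1 : ℕ) + -1 : ℤ).toNat = n := by intro n; omega
    refine ⟨8 / 27, ?_, ?_⟩ <;> rw [← tendsto_add_atTop_iff_nat 1]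
    · simpa only [e, hG.left.jacobi_succ, mul_one] using h.tendsto_linFormOne_div
    · simpa only [e, hG.left.jacobi_succ, mul_one] using h.tendsto_typeII_div hG
  · have e : ∀ n : ℕ, ((n : ℤ) + 0).toNat = n := by intro n; omega
    refine ⟨4 / 9, ?_, ?_⟩
    · simpa only [e, div_self (h.linFormOne_pos _).ne', one_mul] using h.tendsto_jacobi_diag hG
    · simpa only [e, div_self (h.typeII_one_pos hG _).ne', one_mul] using h.tendsto_jacobi_diag hG
  · have e : ∀ n : ℕ, ((n : ℤ) + 1).toNat = n + 1 := by intro n; omega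
    simp only [e]
    exact ⟨_, h.tendsto_linFormOne_succ_div.mul (h.tendsto_jacobi_sub hG),
      (h.tendsto_typeII_div_succ hG).mul (h.tendsto_jacobi_sub hG)⟩
  · have e : ∀ n : ℕ, ((n : ℤ) + 2).toNat = n + 2 := by intro n; omega
    simp only [e]
    exact ⟨_, h.tendsto_linFormOne_two_div.mul (h.tendsto_jacobi_add_two hG),
      (h.tendsto_typeII_div_two hG).mul (h.tendsto_jacobi_add_two hG)⟩

end
end Admissible

end HyperMOP

end

theorem mainTheorem5 (a b c d : ℝ) (ha : 0 < a) (hb : 0 < b) (hd : max a b < d)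
    (hac : a ≤ c) (hbc : b ≤ c + 1) (hcb : ∀ k : ℕ, c - b ≠ -(k : ℝ)) :
    -- the system is perfect: the moment matrix has a Gauss-Borel factorization
    (∃ (S : ℕ → ℕ → ℝ) (H : ℕ → ℝ) (T : ℕ → ℕ → ℝ),
      HyperMOP.IsGaussBorel (HyperMOP.moment a b c d) S H T) ∧
    ∀ (S : ℕ → ℕ → ℝ) (H : ℕ → ℝ) (T : ℕ → ℕ → ℝ),
      HyperMOP.IsGaussBorel (HyperMOP.moment a b c d) S H T →
      -- the normalizing factors do not vanish, so that both matrices are well defined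
      (∀ n, 0 < HyperMOP.typeII S n 1 ∧ 0 < HyperMOP.linForm a b c d H T n 1) ∧
      ∀ k ∈ ({-2, -1, 0, 1, 2} : Set ℤ), ∃ L : ℝ,
        Tendsto (fun n : ℕ => HyperMOP.PI a b c d S H T n ((n : ℤ) + k).toNat) atTop (𝓝 L) ∧
        Tendsto (fun n : ℕ => HyperMOP.PII S ((n : ℤ) + k).toNat n) atTop (𝓝 L) := by
  have h : HyperMOP.Admissible a b c d :=
    { a_pos := ha
      b_pos := hb
      a_lt_d := (le_max_left a b).trans_lt hd
      b_lt_d := (le_max_right a b).trans_lt hd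
      a_le_c := hac
      -- Since `c - b ≥ -1`, only the excluded values `-1` and `0` matter.
      b_lt_c := lt_of_le_of_ne hbc fun e => hcb 1 (by push_cast; linarith)
      c_ne_b := fun e => hcb 0 (by simp [e]) }
  exact ⟨h.exists_isGaussBorel, fun S H T hG =>
    ⟨fun n => ⟨h.typeII_one_pos hG n, by rw [h.linForm_one hG]; exact h.linFormOne_pos n⟩,
      fun k hk => h.exists_tendsto_PI_PII hG hk⟩⟩
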